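/- **Setting.** Fix $0<q<1$, an integer $J\ge 1$ and real parameters $0<s_x<1$, $\xi_x>0$ $(x\ge 2)$, $u_t<0$ $(t\ge 1)$. Write $(z;q)_n=\prod_{k=0}^{n-1}(1-zq^k)$ and $(z;q)_\infty=\prod_{k\ge 0}(1-zq^k)$. *Weights.* For $g\in\mathbb Z_{\ge0}$ the unfused vertex weights $\mathsf L_{z,s}(i,j\,|\,i',j')$ are $$\mathsf L_{z,s}(g,0|g,0)=\tfrac{1-q^g sz}{1-sz},\quad \mathsf L_{z,s}(g,0|g-1,1)=\tfrac{-sz+q^g sz}{1-sz},\quad \mathsf L_{z,s}(g,1|g,1)=\tfrac{-sz+s^2q^g}{1-sz},\quad \mathsf L_{z,s}(g,1|g+1,0)=\tfrac{1-s^2q^g}{1-sz},$$ and $0$ otherwise. The fused weights are, for $0\le j,j'\le J$ and $i+j=i'+j'$, $$\mathsf L^{(J)}_{z,s}(i,j|i',j')=\sum_{\substack{h,h'\in\{0,1\}^J\\ |h|=j,\ |h'|=j'}}\frac{q^{\sum_{k=1}^J (k-1)h_k}}{Z_J(j)}\prod_{k=1}^J \mathsf L_{q^{k-1}z,s}(i_{k-1},h_k|i_k,h'_k),\qquad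 i_0=i,\quad i_k=i_{k-1}+h_k-h'_k,$$ with $Z_J(j)=q^{j(j-1)/2}\frac{(q;q)_J}{(q;q)_j(q;q)_{J-j}}$ (terms in which some $i_k$ is negative are zero), and $\mathsf L^{(J)}_{z,s}(i,j|i',j')=0$ otherwise. Thus $\mathsf L^{(1)}=\mathsf L$. *Model.* A configuration of up-right paths on $\Lambda_{1,0}=(\mathbb Z_{\ge1}\times\mathbb Z_{\ge0})\setminus\{(1,0)\}$, with at most $J$ paths on each horizontal edge, is recorded by the numbers $\mathsf m_x^t$ $(x\ge2,t\ge0)$ and $\mathsf j_x^t\in\{0,\dots,J\}$ $(x\ge1,t\ge1)$ of paths leaving $(x,t)$ upwards, respectively to the right; they satisfy $\mathsf m_x^{t-1}+\mathsf j_{x-1}^t=\mathsf m_x^t+\mathsf j_x^t$ for $x\ge2,t\ge1$. A probability measure $\mathcal P$ on configurations is a (fused) Higher Spin Six Vertex Model if for all $x\ge2$, $t\ge1$, conditionally on all occupation numbers of the edges leaving boundary vertices (those with $x=1$ or $t=0$) or vertices $(y,r)$ with $y<x$ or $r<t$, the pair $(\mathsf m_x^t,\mathsf j_x^t)$ equals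 $(i',j')$ with probability $\mathsf L^{(J)}_{\xi_xu_t,s_x}(\mathsf m_x^{t-1},\mathsf j_{x-1}^t\,|\,i',j')$. The joint law of the boundary variables $\mathsf m_x^0$ $(x\ge2)$, $\mathsf j_1^t$ $(t\ge1)$ is arbitrary. *Burke property.* $\mathcal P$ has the Burke property if there are probability laws $\{P^{(x)}\}_{x\ge2}$, $\{\tilde P^{(t)}\}_{t\ge1}$ on $\mathbb Z_{\ge0}$ such that for every $(x',t')\in\mathbb Z_{\ge1}\times\mathbb Z_{\ge0}$ the random variables $\mathsf m_{x'+k}^{t'}$, $\mathsf j_{x'}^{t'+k}$ $(k\ge1)$ are mutually independent, with $\mathsf m_{x'+k}^{t'}\sim P^{(x'+k)}$ and $\mathsf j_{x'}^{t'+k}\sim\tilde P^{(t'+k)}$. *$q$-negative binomial law.* $X\sim q\mathrm{NB}(b,p)$ means $\mathbb P(X=n)=p^n\frac{(b;q)_n}{(q;q)_n}\frac{(p;q)_\infty}{(pb;q)_\infty}$ for all $n\ge0$. **Proposition.** A (fused) Higher Spin Six Vertex Model $\mathcal P$ on $\Lambda_{1,0}$ has the Burke property if and only if there is a real number $d$ with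 $d\ge 0$ and $d<\xi_xs_x$ for every $x\ge2$ such that the boundary variables $\mathsf m_x^0$ $(x\ge2)$, $\mathsf j_1^t$ $(t\ge1)$ are mutually independent with $$\mathsf m_x^0\sim q\mathrm{NB}\big(s_x^2,\ d/(\xi_xs_x)\big)\quad(x\ge2),\qquad \mathsf j_1^t\sim q\mathrm{NB}\big(q^{-J},\ q^J d\,u_t\big)\quad(t\ge1).$$ -/

import Mathlib

open MeasureTheory ProbabilityTheory

/-- The finite q-Pochhammer symbol `(z; q)_n = (1 - z)(1 - z q) ⋯ (1 - z q^(n-1))`. -/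
noncomputable def qPoch (q z : ℝ) (n : ℕ) : ℝ :=
  ∏ k ∈ Finset.range n, (1 - z * q ^ k)

/-- The infinite q-Pochhammer symbol `(z; q)_∞ = ∏_{k ≥ 0} (1 - z q^k)`
(a convergent product for `|q| < 1`). -/
noncomputable def qPochInf (q z : ℝ) : ℝ :=
  ∏' k : ℕ, (1 - z * q ^ k)

/-- The stochastic vertex weight `L_{z,s}(i, j | i', j')` of the unfused model, where `z = ξ_x u_t`;
`i`, `j` paths enter from below and from the left, `i'`, `j'` paths exit upwards and to the right. -/
noncomputable def vertexWeight (q z s : ℝ) (i j i' j' : ℕ) : ℝ :=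
  if i + j = i' + j' then
    match j, j' with
    | 0, 0 => (1 - q ^ i * (s * z)) / (1 - s * z)
    | 0, 1 => (-(s * z) + q ^ i * (s * z)) / (1 - s * z)
    | 1, 1 => (-(s * z) + s ^ 2 * q ^ i) / (1 - s * z)
    | 1, 0 => (1 - s ^ 2 * q ^ i) / (1 - s * z)
    | _, _ => 0
  else 0

/-- In a column of `J` unfused vertices that `i` paths enter from below, with `h k` paths entering
vertex `k` from the left and `h' k` paths leaving it to the right, the number of paths on the
vertical edge just below vertex `k` (just above the column for `k = J`). If the difference is
truncated, then some vertex of the column violates conservation and its weight is `0`. -/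
def columnHeight {J : ℕ} (i : ℕ) (h h' : Fin J → Fin 2) (k : ℕ) : ℕ :=
  (i + ∑ l : Fin J, if (l : ℕ) < k then (h l : ℕ) else 0)
    - ∑ l : Fin J, if (l : ℕ) < k then (h' l : ℕ) else 0

/-- The normalisation `Z_J(j) = q^(j(j-1)/2) (q;q)_J / ((q;q)_j (q;q)_(J-j))` of the q-exchangeable
distributions on `{0,1}^J`, for `j ≤ J`. -/
noncomputable def qExchNorm (q : ℝ) (J j : ℕ) : ℝ :=
  q ^ (j * (j - 1) / 2) * (qPoch q q J / (qPoch q q j * qPoch q q (J - j)))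

/-- The fused weight `L^{(J)}_{z,s}(i, j | i', j')`: collapse a column of `J` unfused vertices with
spectral parameters `z, q z, …, q^(J-1) z` (from bottom to top), where the `j` paths that enter
from the left are arranged according to the q-exchangeable law `q^(∑ k h_k) / Z_J(j)`
(with `k = 0, …, J-1`) and the exit arrangement is summed out. For `J = 1` it is the unfused weight;
it vanishes if `j > J` or `j' > J`. -/
noncomputable def fusedWeight (q : ℝ) (J : ℕ) (z s : ℝ) (i j i' j' : ℕ) : ℝ :=
  ∑ h : Fin J → Fin 2, ∑ h' : Fin J → Fin 2,
    if (∑ k, (h k : ℕ)) = j ∧ (∑ k, (h' k : ℕ)) = j' ∧ i + j = i' + j' then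
      q ^ (∑ k : Fin J, (k : ℕ) * (h k : ℕ)) / qExchNorm q J j *
        ∏ k : Fin J, vertexWeight q (q ^ (k : ℕ) * z) s
          (columnHeight i h h' k) (h k) (columnHeight i h h' (k + 1)) (h' k)
    else 0

/-- Configurations of up-right directed paths on `Λ_{1,0} = (ℤ_{≥1} × ℤ_{≥0}) \ {(1,0)}` with at most
`J` paths on a horizontal edge, recorded by their occupation numbers. Indices are shifted so as to
start at `0`:
* `m a b` is the number of paths leaving the vertex `(x,t) = (a+2, b)` upwards,
* `j a b` is the number of paths leaving the vertex `(x,t) = (a+1, b+1)` to the right.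
Hence the bulk vertex `(a+2, b+1)` has incoming edges `m a b` (from below), `j a b` (from the left) and
outgoing edges `m a (b+1)` (upwards), `j (a+1) b` (to the right); the boundary data are `m a 0` and
`j 0 b`. -/
structure PathConfig (J : ℕ) where
  m : ℕ → ℕ → ℕ
  j : ℕ → ℕ → ℕ
  j_le : ∀ a b, j a b ≤ J
  conservation : ∀ a b, m a b + j a b = m a (b + 1) + j (a + 1) b

/-- The σ-algebra generated by all occupation numbers. -/
instance (J : ℕ) : MeasurableSpace (PathConfig J) :=
  MeasurableSpace.comap (fun p => (p.m, p.j)) inferInstance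

/-- The information outside the future of the bulk vertex `(a+2, b+1)`: the σ-algebra generated by
the occupation numbers of the edges that leave a boundary vertex, or a bulk vertex `(x,t)` with
`x < a+2` or `t < b+1`. -/
@[reducible] def past {J : ℕ} (a b : ℕ) : MeasurableSpace (PathConfig J) :=
  (⨆ (c : ℕ) (r : ℕ) (_ : c < a ∨ r ≤ b), MeasurableSpace.comap (fun p => p.m c r) ⊤) ⊔
  (⨆ (c : ℕ) (r : ℕ) (_ : c ≤ a ∨ r < b), MeasurableSpace.comap (fun p => p.j c r) ⊤)

/-- The law `μ` on path configurations is a (fused) higher spin six vertex model: at each bulk vertex,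
conditionally on the past, the outgoing numbers of paths are sampled by the fused stochastic weight
from the incoming numbers. Parameters are shifted like the configurations: `ξ a`, `s a` belong to the
column `x = a+2` and `u b` to the row `t = b+1`. No law is prescribed on the boundary. -/
def IsHS6VM {J : ℕ} (q : ℝ) (ξ s u : ℕ → ℝ) (μ : Measure (PathConfig J)) : Prop :=
  ∀ a b i' j' : ℕ,
    μ⟦{p : PathConfig J | p.m a (b + 1) = i' ∧ p.j (a + 1) b = j'} | past a b⟧ =ᵐ[μ]
      fun p => fusedWeight q J (ξ a * u b) (s a) (p.m a b) (p.j a b) i' j'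

/-- The boundary data of the sublattice `Λ_{x',t'}` with `(x',t') = (a+1, b)`: the numbers
`m_{x'+k}^{t'}` (left summand) and `j_{x'}^{t'+k}` (right summand) for `k ≥ 1`. For `a = b = 0` these
are the boundary data of `Λ_{1,0}`. -/
def boundaryData {J : ℕ} (a b : ℕ) : ℕ ⊕ ℕ → PathConfig J → ℕ
  | Sum.inl k => fun p => p.m (a + k) b
  | Sum.inr k => fun p => p.j a (b + k)

/-- Burke's property: for two families of probability laws, `P` indexed by columns and `P'` indexed by
rows, the boundary data of every sublattice `Λ_{x',t'}` are independent, with the law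
attached to the column (for vertical edges) or to the row (for horizontal edges). -/
def BurkeProperty {J : ℕ} (μ : Measure (PathConfig J)) : Prop :=
  ∃ P P' : ℕ → Measure ℕ,
    (∀ x, IsProbabilityMeasure (P x)) ∧ (∀ t, IsProbabilityMeasure (P' t)) ∧
    ∀ a b : ℕ,
      iIndepFun (boundaryData (J := J) a b) μ ∧
      (∀ k, HasLaw (fun p : PathConfig J => p.m (a + k) b) (P (a + k)) μ) ∧
      (∀ k, HasLaw (fun p : PathConfig J => p.j a (b + k)) (P' (b + k)) μ)

/-- `X ∼ qNB(β, p)`, the q-negative binomial law: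
`ℙ(X = n) = p^n (β;q)_n / (q;q)_n · (p;q)_∞ / (pβ;q)_∞` for all `n ≥ 0`. -/
def IsQNB {Ω : Type*} [MeasurableSpace Ω] (μ : Measure Ω) (q β p : ℝ) (X : Ω → ℕ) : Prop :=
  ∀ n : ℕ, μ.real {ω | X ω = n} =
    p ^ n * (qPoch q β n / qPoch q q n) * (qPochInf q p / qPochInf q (p * β))

/-! Paths are conserved at a vertex, so a vertex acts as a finite Markov kernel on each level `i + j
= N`, and a stationary product weight stays stationary after multiplication by `d ^ (i + j)`. For an
unfused vertex, vertical weights `c^n (s²;q)_n / (q;q)_n` and a left edge of relative weight `-c s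
z` are stationary (`vertexStep_qnbWeight`). Up a column the edge weights become `-c s z q^k`, which
is the q-exchangeable entry law, so the fused vertex preserves the product of the two q-negative
binomial weights (`sum_qnbWeight_mul_fusedWeight`). With `c = 1 / (ξ s)` the horizontal weight
depends only on the row and the vertical one only on the column, so one `d` serves every vertex.

Sufficiency: stationarity lets a down-right path be pushed over one corner at a time without
changing its product law (`HasProductMass.update_pair`). Finitely many such moves turn the axes into
any prescribed finite part of the boundary of a quadrant.

Necessity: at each vertex the Burke property gives independent inputs with laws `P`, `P'` and
outputs with the same marginals; independence of the outputs is not needed. Let `r` be the density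
of `P ⊗ P'` relative to the stationary weight, and `D` the input mass minus the output mass. The
entropy production of a level is the sum of `D log r` over it, and is nonnegative
(`entropy_production_nonneg`). But `log r = f i + g j`, while both marginals of `D` vanish, so the
total should be zero. `level_sum_eq_zero` justifies this by truncation, without any moment
assumption on `P`. Hence every level has zero production, and positivity of the kernel makes `r`
constant on levels (`density_const_on_levels`); a product `f i * g j` depending only on `i + j` is
geometric. Its ratio `d` can be read off from the column law alone or from the row law alone, so it
is global. Summability gives `d < ξ s`, and the q-binomial theorem gives the normalising constants.
-/

/-! ### q-negative binomial weights -/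

/-- The unnormalised q-negative binomial weight `p^n (β;q)_n / (q;q)_n`. -/
noncomputable def qnbWeight (q β p : ℝ) (n : ℕ) : ℝ :=
  p ^ n * (qPoch q β n / qPoch q q n)

lemma qPoch_zero (q z : ℝ) : qPoch q z 0 = 1 := by simp [qPoch]

lemma qPoch_succ (q z : ℝ) (n : ℕ) : qPoch q z (n + 1) = qPoch q z n * (1 - z * q ^ n) := by
  simp [qPoch, Finset.prod_range_succ]

lemma qPoch_pos {q z : ℝ} (hq0 : 0 < q) (hq1 : q < 1) (hz : z < 1) (n : ℕ) :
    0 < qPoch q z n := by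
  refine Finset.prod_pos fun k _ => ?_
  have h1 : q ^ k ≤ 1 := pow_le_one₀ hq0.le hq1.le
  have h2 : 0 < q ^ k := pow_pos hq0 k
  nlinarith

lemma qnbWeight_zero (q β p : ℝ) : qnbWeight q β p 0 = 1 := by
  simp [qnbWeight, qPoch_zero]

lemma one_sub_pow_succ_pos {q : ℝ} (hq0 : 0 < q) (hq1 : q < 1) (n : ℕ) : 0 < 1 - q ^ (n + 1) :=
  sub_pos.2 (pow_lt_one₀ hq0.le hq1 (Nat.succ_ne_zero n))

/-- The two-term recursion, free of division on the left. Vertex stationarity, the q-binomial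
theorem and the growth bound on logarithms all reduce to it. -/
lemma qnbWeight_succ {q : ℝ} (hq0 : 0 < q) (hq1 : q < 1) (β p : ℝ) (n : ℕ) :
    qnbWeight q β p (n + 1) * (1 - q ^ (n + 1)) = qnbWeight q β p n * (p * (1 - β * q ^ n)) := by
  have h1 : qPoch q q n ≠ 0 := (qPoch_pos hq0 hq1 hq1 n).ne'
  have h2 := (one_sub_pow_succ_pos hq0 hq1 n).ne'
  rw [pow_succ] at h2 ⊢
  simp only [qnbWeight, qPoch_succ]
  field_simp
  ring

/-- Isolates the parameter `d` as a factor `d ^ n`, a fugacity for paths that conservation carries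
through every vertex. -/
lemma qnbWeight_mul (q β p d : ℝ) (n : ℕ) :
    qnbWeight q β (d * p) n = d ^ n * qnbWeight q β p n := by
  simp only [qnbWeight, mul_pow]; ring

lemma qnbWeight_pos {q β p : ℝ} (hq0 : 0 < q) (hq1 : q < 1) (hβ : β < 1) (hp : 0 < p) (n : ℕ) :
    0 < qnbWeight q β p n :=
  mul_pos (pow_pos hp n) (div_pos (qPoch_pos hq0 hq1 hβ n) (qPoch_pos hq0 hq1 hq1 n))

/-! ### The unfused vertex: positivity and stationarity -/

lemma fin_two_coe_le (h : Fin 2) : (h : ℕ) ≤ 1 := Nat.lt_succ_iff.1 h.isLt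

lemma vertexWeight_eq_zero_of_ne (q z s : ℝ) {i j i' j' : ℕ} (h : i + j ≠ i' + j') :
    vertexWeight q z s i j i' j' = 0 := by
  simp [vertexWeight, h]

lemma vertexWeight_pos {q z s : ℝ} (hq0 : 0 < q) (hq1 : q < 1) (hs0 : 0 < s) (hs1 : s < 1)
    (hz : z < 0) {i j i' j' : ℕ} (h : i + j = i' + j') (hj : j ≤ 1) (hj' : j' ≤ 1) :
    0 < vertexWeight q z s i j i' j' := by
  have hsz : 0 < -(s * z) := by nlinarith
  have hq : 0 < q ^ i := pow_pos hq0 i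
  have hq' : q ^ i ≤ 1 := pow_le_one₀ hq0.le hq1.le
  have hs2 : s ^ 2 < 1 := by nlinarith
  have hs2' : 0 < s ^ 2 := by positivity
  have hden : 0 < 1 - s * z := by linarith
  interval_cases j <;> interval_cases j' <;> simp only [vertexWeight, if_pos h]
  · exact div_pos (by nlinarith : 0 < 1 - q ^ i * (s * z)) hden
  · have hi : q ^ i < 1 := pow_lt_one₀ hq0.le hq1 (by omega)
    exact div_pos (by nlinarith : 0 < -(s * z) + q ^ i * (s * z)) hden
  · exact div_pos (by nlinarith : 0 < 1 - s ^ 2 * q ^ i) hden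
  · exact div_pos (by nlinarith : 0 < -(s * z) + s ^ 2 * q ^ i) hden

lemma vertexWeight_nonneg {q z s : ℝ} (hq0 : 0 < q) (hq1 : q < 1) (hs0 : 0 < s) (hs1 : s < 1)
    (hz : z < 0) (i i' : ℕ) {j j' : ℕ} (hj : j ≤ 1) (hj' : j' ≤ 1) :
    0 ≤ vertexWeight q z s i j i' j' := by
  by_cases h : i + j = i' + j'
  · exact (vertexWeight_pos hq0 hq1 hs0 hs1 hz h hj hj').le
  · rw [vertexWeight_eq_zero_of_ne q z s h]

/-- One step of the column transfer operator: `φ` is a density on the vertical edge below a vertex,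
a path enters from the left with relative weight `x`, and `e` paths leave to the right. -/
noncomputable def vertexStep (q z s x : ℝ) (e : Fin 2) (φ : ℕ → ℝ) (m : ℕ) : ℝ :=
  ∑ h : Fin 2, if (h : ℕ) ≤ m + e then
    φ (m + e - h) * x ^ (h : ℕ) * vertexWeight q z s (m + e - h) h m e else 0

lemma vertexStep_smul (q z s x : ℝ) (e : Fin 2) (c : ℝ) (φ : ℕ → ℝ) :
    vertexStep q z s x e (fun n => c * φ n) = fun m => c * vertexStep q z s x e φ m := by
  funext m
  simp only [vertexStep, Finset.mul_sum, mul_ite, mul_zero, mul_assoc]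

/-- The q-negative binomial weights are stationary for a single vertex. -/
lemma vertexStep_qnbWeight {q z s : ℝ} (hq0 : 0 < q) (hq1 : q < 1) (hs0 : 0 < s)
    (hz : z < 0) (c : ℝ) (e : Fin 2) :
    vertexStep q z s (-(c * s * z)) e (qnbWeight q (s ^ 2) c) =
      fun m => (-(c * s * z)) ^ (e : ℕ) * qnbWeight q (s ^ 2) c m := by
  have hden : 1 - s * z ≠ 0 := by nlinarith
  funext m
  have key := qnbWeight_succ hq0 hq1 (s ^ 2) c
  fin_cases e
  · cases m with
    | zero =>
      simp [vertexStep, vertexWeight]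
      field_simp
    | succ n =>
      simp [vertexStep, vertexWeight]
      field_simp
      linear_combination (s * z) * key n
  · simp [vertexStep, vertexWeight]
    field_simp
    linear_combination (-z) * key m

/-! ### Columns of vertices -/

/-- The product of the weights of a column of `J` vertices. -/
noncomputable def columnWeight (q : ℝ) (J : ℕ) (z s : ℝ) (i : ℕ) (h h' : Fin J → Fin 2) : ℝ :=
  ∏ k : Fin J, vertexWeight q (q ^ (k : ℕ) * z) s
    (columnHeight i h h' k) (h k) (columnHeight i h h' (k + 1)) (h' k)

lemma columnHeight_zero {J : ℕ} (i : ℕ) (h h' : Fin J → Fin 2) : columnHeight i h h' 0 = i := by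
  simp [columnHeight]

lemma columnHeight_cons_succ {J : ℕ} (i : ℕ) (e e' : Fin 2) (h h' : Fin J → Fin 2) (k : ℕ)
    (he : (e' : ℕ) ≤ i + e) :
    columnHeight i (Fin.cons e h : Fin (J + 1) → Fin 2) (Fin.cons e' h' : Fin (J + 1) → Fin 2)
      (k + 1) = columnHeight (i + e - e') h h' k := by
  simp only [columnHeight, Fin.sum_univ_succ, Fin.cons_zero, Fin.cons_succ, Fin.val_zero,
    Fin.val_succ, Nat.zero_lt_succ, if_true, Nat.add_lt_add_iff_right]
  omega

lemma columnWeight_cons (q : ℝ) {J : ℕ} (z s : ℝ) (i : ℕ) (e e' : Fin 2) (h h' : Fin J → Fin 2) :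
    columnWeight q (J + 1) z s i (Fin.cons e h) (Fin.cons e' h') =
      vertexWeight q z s i e (i + e - e') e' * columnWeight q J (q * z) s (i + e - e') h h' := by
  by_cases he : (e' : ℕ) ≤ i + e
  · simp only [columnWeight, Fin.prod_univ_succ, Fin.cons_zero, Fin.cons_succ, Fin.val_zero,
      Fin.val_succ, columnHeight_cons_succ i e e' h h' _ he, columnHeight_zero, pow_zero, one_mul]
    simp only [pow_succ, mul_assoc]
  -- Here `i + e - e'` is truncated; both sides vanish because the bottom vertex violates
  -- conservation.
  · have hne : ∀ n : ℕ, i + e ≠ n + e' := fun n => by omega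
    rw [vertexWeight_eq_zero_of_ne _ _ _ (hne _), zero_mul, columnWeight, Fin.prod_univ_succ]
    simp only [Fin.cons_zero, Fin.val_zero, columnHeight_zero]
    rw [vertexWeight_eq_zero_of_ne _ _ _ (hne _), zero_mul]

/-- The number of paths in an arrangement. -/
def pathCount {J : ℕ} (h : Fin J → Fin 2) : ℕ := ∑ k, (h k : ℕ)

/-- The weight `∏ (x q^k)^(h_k)` of an arrangement. -/
noncomputable def arrangementWeight (q x : ℝ) {J : ℕ} (h : Fin J → Fin 2) : ℝ :=
  ∏ k : Fin J, (x * q ^ (k : ℕ)) ^ (h k : ℕ)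

lemma pathCount_cons {J : ℕ} (e : Fin 2) (h : Fin J → Fin 2) :
    pathCount (Fin.cons e h : Fin (J + 1) → Fin 2) = e + pathCount h := by
  simp [pathCount, Fin.sum_univ_succ]

lemma arrangementWeight_cons (q x : ℝ) {J : ℕ} (e : Fin 2) (h : Fin J → Fin 2) :
    arrangementWeight q x (Fin.cons e h : Fin (J + 1) → Fin 2) =
      x ^ (e : ℕ) * arrangementWeight q (q * x) h := by
  simp only [arrangementWeight, Fin.prod_univ_succ, Fin.cons_zero, Fin.cons_succ, Fin.val_zero,
    Fin.val_succ, pow_zero, mul_one]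
  congr 1
  refine Finset.prod_congr rfl fun k _ => ?_
  ring

lemma pathCount_le {J : ℕ} (h : Fin J → Fin 2) : pathCount h ≤ J := by
  calc pathCount h ≤ ∑ _k : Fin J, 1 := Finset.sum_le_sum fun k _ => fin_two_coe_le _
    _ = J := by simp

lemma arrangementWeight_eq (q x : ℝ) {J : ℕ} (h : Fin J → Fin 2) :
    arrangementWeight q x h = x ^ pathCount h * q ^ (∑ k : Fin J, (k : ℕ) * (h k : ℕ)) := by
  simp only [arrangementWeight, pathCount, mul_pow, Finset.prod_mul_distrib,
    Finset.prod_pow_eq_pow_sum, ← pow_mul]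

/-- A sum over arrangements of `J + 1` edges, split at the bottom edge. -/
lemma sum_arrangement_succ {J : ℕ} (F : (Fin (J + 1) → Fin 2) → ℝ) :
    ∑ h, F h = ∑ h : Fin J → Fin 2, ∑ e : Fin 2, F (Fin.cons e h) := by
  rw [← (Fin.consEquiv fun _ : Fin (J + 1) => Fin 2).sum_comp, Fintype.sum_prod_type_right]
  rfl

/-- The column transfer operator. -/
noncomputable def columnStep (q : ℝ) {J : ℕ} (z s x : ℝ) (h' : Fin J → Fin 2) (φ : ℕ → ℝ)
    (m : ℕ) : ℝ :=
  ∑ h : Fin J → Fin 2, if pathCount h ≤ m + pathCount h' then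
    φ (m + pathCount h' - pathCount h) * arrangementWeight q x h *
      columnWeight q J z s (m + pathCount h' - pathCount h) h h' else 0

/-- A column is its bottom vertex followed by a shorter column, in which the spectral parameter and
the edge weight are both multiplied by `q`. This drives the induction on `J`. -/
lemma columnStep_cons (q : ℝ) {J : ℕ} (z s x : ℝ) (e' : Fin 2) (h' : Fin J → Fin 2)
    (φ : ℕ → ℝ) (m : ℕ) :
    columnStep q z s x (Fin.cons e' h' : Fin (J + 1) → Fin 2) φ m =
      columnStep q (q * z) s (q * x) h' (vertexStep q z s x e' φ) m := by
  simp only [columnStep]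
  rw [sum_arrangement_succ]
  refine Finset.sum_congr rfl fun h _ => ?_
  simp only [pathCount_cons, arrangementWeight_cons, columnWeight_cons]
  split_ifs with hle
  · simp only [vertexStep, Finset.sum_mul]
    refine Finset.sum_congr rfl fun e _ => ?_
    have h1 : m + (↑e' + pathCount h') - (↑e + pathCount h) =
        m + pathCount h' - pathCount h + ↑e' - ↑e := by omega
    by_cases hc : (e : ℕ) ≤ m + pathCount h' - pathCount h + ↑e'
    · rw [if_pos (by omega), if_pos hc, h1, Nat.sub_add_cancel hc, Nat.add_sub_cancel]
      ring
    · rw [if_neg (by omega), if_neg hc, zero_mul, zero_mul]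
  -- The only term left has `e = 0`, `e' = 1` and nothing entering from below: the bottom vertex
  -- would emit a path that it does not have.
  · refine Finset.sum_eq_zero fun e _ => ?_
    split_ifs with hc
    · have := fin_two_coe_le e'
      rw [vertexWeight_eq_zero_of_ne]
      · ring
      · omega
    · rfl

/-- The q-negative binomial weights are stationary for a column of vertices. -/
lemma columnStep_qnbWeight {q s : ℝ} (hq0 : 0 < q) (hq1 : q < 1) (hs0 : 0 < s) (c : ℝ)
    {J : ℕ} (h' : Fin J → Fin 2) :
    ∀ {z : ℝ}, z < 0 → ∀ (a : ℝ) (m : ℕ),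
      columnStep q z s (-(c * s * z)) h' (fun n => a * qnbWeight q (s ^ 2) c n) m =
        a * (arrangementWeight q (-(c * s * z)) h' * qnbWeight q (s ^ 2) c m) := by
  induction J with
  | zero =>
    intro z _ a m
    simp [columnStep, pathCount, arrangementWeight, columnWeight]
  | succ J ih =>
    intro z hz a m
    obtain ⟨e', g, rfl⟩ : ∃ e' g, h' = Fin.cons e' g := ⟨h' 0, Fin.tail h', (Fin.cons_self_tail h').symm⟩
    rw [columnStep_cons, vertexStep_smul, vertexStep_qnbWeight hq0 hq1 hs0 hz,
      arrangementWeight_cons]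
    -- The relation between edge weight and spectral parameter survives the shift `z ↦ q z`, so the
    -- same vertical weight is stationary at every height of the column.
    have hx : q * -(c * s * z) = -(c * s * (q * z)) := by ring
    rw [hx]
    have := ih g (z := q * z) (by nlinarith) (a * (-(c * s * z)) ^ (e' : ℕ)) m
    simp only [mul_assoc] at this ⊢
    exact this

/-! ### q-exchangeable laws and stationarity of the fused vertex -/

lemma qPoch_q_succ (q : ℝ) (n : ℕ) : qPoch q q (n + 1) = qPoch q q n * (1 - q ^ (n + 1)) := by
  rw [qPoch_succ, pow_succ']

lemma qExchNorm_pos {q : ℝ} (hq0 : 0 < q) (hq1 : q < 1) (J j : ℕ) : 0 < qExchNorm q J j := by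
  have h := qPoch_pos hq0 hq1 hq1
  exact mul_pos (pow_pos hq0 _) (div_pos (h _) (mul_pos (h _) (h _)))

lemma triangle_succ (j : ℕ) : (j + 1) * (j + 1 - 1) / 2 = j * (j - 1) / 2 + j := by
  rw [← Finset.sum_range_id_mul_two, ← Finset.sum_range_id_mul_two, Nat.mul_div_cancel _ two_pos,
    Nat.mul_div_cancel _ two_pos, Finset.sum_range_succ]

/-- The q-Pascal rule for the q-exchangeable normalisation. -/
lemma qExchNorm_succ_succ {q : ℝ} (hq0 : 0 < q) (hq1 : q < 1) {J j : ℕ} (hj : j + 1 ≤ J) :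
    qExchNorm q (J + 1) (j + 1) =
      q ^ (j + 1) * qExchNorm q J (j + 1) + q ^ j * qExchNorm q J j := by
  obtain ⟨n, rfl⟩ := Nat.exists_eq_add_of_le hj
  have h := fun n => (qPoch_pos hq0 hq1 hq1 n).ne'
  have h' := fun n => (one_sub_pow_succ_pos hq0 hq1 n).ne'
  have e1 : j + 1 + n + 1 - (j + 1) = n + 1 := by omega
  have e2 : j + 1 + n - (j + 1) = n := by omega
  have e3 : j + 1 + n - j = n + 1 := by omega
  have e4 : j + 1 + n = (j + n) + 1 := by omega
  simp only [qExchNorm, e1, e2, e3, triangle_succ]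
  rw [qPoch_q_succ q (j + 1 + n), qPoch_q_succ q n, qPoch_q_succ q j]
  have a1 := h (j + 1 + n); have a2 := h n; have a3 := h j; have a4 := h' n; have a5 := h' j
  field_simp
  ring

lemma qExchNorm_self {q : ℝ} (hq0 : 0 < q) (hq1 : q < 1) (J : ℕ) :
    qExchNorm q J J = q ^ (J * (J - 1) / 2) := by
  have h := (qPoch_pos hq0 hq1 hq1 J).ne'
  simp [qExchNorm, qPoch_zero, h]

lemma qExchNorm_zero {q : ℝ} (hq0 : 0 < q) (hq1 : q < 1) (J : ℕ) : qExchNorm q J 0 = 1 := by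
  have h := (qPoch_pos hq0 hq1 hq1 J).ne'
  simp [qExchNorm, qPoch_zero, h]

/-- The Gauss binomial formula: total weight of the arrangements of `j` paths. -/
lemma sum_arrangementWeight {q : ℝ} (hq0 : 0 < q) (hq1 : q < 1) (J j : ℕ) (hj : j ≤ J) :
    ∀ x : ℝ, (∑ h : Fin J → Fin 2, if pathCount h = j then arrangementWeight q x h else 0) =
      x ^ j * qExchNorm q J j := by
  induction J generalizing j with
  | zero =>
    intro x
    obtain rfl : j = 0 := by omega
    simp [pathCount, arrangementWeight, qExchNorm_zero hq0 hq1]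
  | succ J ih =>
    intro x
    have hsplit : (∑ h : Fin (J + 1) → Fin 2,
        if pathCount h = j then arrangementWeight q x h else 0) =
        (∑ h : Fin J → Fin 2, if pathCount h = j then arrangementWeight q (q * x) h else 0) +
        x * ∑ h : Fin J → Fin 2,
          if 1 + pathCount h = j then arrangementWeight q (q * x) h else 0 := by
      rw [sum_arrangement_succ, Finset.mul_sum, ← Finset.sum_add_distrib]
      refine Finset.sum_congr rfl fun h _ => ?_
      simp [pathCount_cons, arrangementWeight_cons, mul_ite]
    rw [hsplit]
    cases j with
    | zero =>
      rw [ih 0 (Nat.zero_le _)]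
      simp [qExchNorm_zero hq0 hq1]
    | succ j =>
      have e1 : ∀ h : Fin J → Fin 2, (1 + pathCount h = j + 1) = (pathCount h = j) :=
        fun h => propext (by omega)
      simp only [e1]
      rw [ih j (by omega)]
      rcases Nat.lt_or_ge J (j + 1) with hlt | hge
      · obtain rfl : j = J := by omega
        rw [Finset.sum_eq_zero, qExchNorm_self hq0 hq1, qExchNorm_self hq0 hq1, triangle_succ]
        · ring
        · intro h _
          rw [if_neg]
          have := pathCount_le h
          omega
      · rw [ih (j + 1) hge, qExchNorm_succ_succ hq0 hq1 hge]
        ring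

lemma qPoch_inv_pow_eq_zero {q : ℝ} (hq0 : 0 < q) {J j : ℕ} (hj : J < j) :
    qPoch q (q ^ J)⁻¹ j = 0 := by
  refine Finset.prod_eq_zero (Finset.mem_range.2 hj) ?_
  rw [inv_mul_cancel₀ (pow_pos hq0 J).ne', sub_self]

lemma qnbWeight_inv_pow_eq_zero {q : ℝ} (hq0 : 0 < q) (p : ℝ) {J j : ℕ} (hj : J < j) :
    qnbWeight q (q ^ J)⁻¹ p j = 0 := by
  simp [qnbWeight, qPoch_inv_pow_eq_zero hq0 hj]

/-- For `β = q^(-J)` the q-negative binomial weight is the total weight of the arrangements of `j`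
paths with edge weights `-x q^k`. This identifies the horizontal law, and shows it is positive for
`x < 0`. -/
lemma qnbWeight_inv_pow {q : ℝ} (hq0 : 0 < q) (hq1 : q < 1) (x : ℝ) {J j : ℕ} (hj : j ≤ J) :
    qnbWeight q (q ^ J)⁻¹ (q ^ J * x) j = (-x) ^ j * qExchNorm q J j := by
  induction j with
  | zero => rw [qnbWeight_zero, qExchNorm_zero hq0 hq1]; simp
  | succ j ih =>
    specialize ih (by omega)
    obtain ⟨n, rfl⟩ := Nat.exists_eq_add_of_le hj
    have h := fun n => (qPoch_pos hq0 hq1 hq1 n).ne'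
    have h' := fun n => (one_sub_pow_succ_pos hq0 hq1 n).ne'
    refine mul_right_cancel₀ (h' j) ?_
    rw [qnbWeight_succ hq0 hq1, ih]
    have e2 : j + 1 + n - (j + 1) = n := by omega
    have e3 : j + 1 + n - j = n + 1 := by omega
    simp only [qExchNorm, e2, e3, triangle_succ]
    rw [qPoch_q_succ q n, qPoch_q_succ q j]
    have a1 := h (j + 1 + n); have a2 := h n; have a3 := h j; have a4 := h' n; have a5 := h' j
    have a6 : q ≠ 0 := hq0.ne'
    field_simp
    ring

lemma fusedWeight_eq (q : ℝ) (J : ℕ) (z s : ℝ) {i j i' j' : ℕ} (h : i + j = i' + j') :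
    fusedWeight q J z s i j i' j' =
      ∑ h' : Fin J → Fin 2, ∑ h : Fin J → Fin 2, if pathCount h = j ∧ pathCount h' = j' then
        q ^ (∑ k : Fin J, (k : ℕ) * (h k : ℕ)) / qExchNorm q J j * columnWeight q J z s i h h'
      else 0 := by
  rw [Finset.sum_comm]
  refine Finset.sum_congr rfl fun g _ => Finset.sum_congr rfl fun g' _ => ?_
  exact if_congr (by simp [pathCount, h]) rfl rfl

lemma fusedWeight_eq_zero_of_ne (q : ℝ) (J : ℕ) (z s : ℝ) {i j i' j' : ℕ} (h : i + j ≠ i' + j') :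
    fusedWeight q J z s i j i' j' = 0 := by
  simp [fusedWeight, h]

/-- Local stationarity: the product of the q-negative binomial weights is preserved by the fused
vertex weights. -/
theorem sum_qnbWeight_mul_fusedWeight {q s z : ℝ} (hq0 : 0 < q) (hq1 : q < 1) (hs0 : 0 < s)
    (hz : z < 0) (c : ℝ) (J i' j' : ℕ) :
    ∑ p ∈ Finset.HasAntidiagonal.antidiagonal (i' + j'),
      qnbWeight q (s ^ 2) c p.1 * qnbWeight q (q ^ J)⁻¹ (q ^ J * (c * s * z)) p.2 *
        fusedWeight q J z s p.1 p.2 i' j' =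
      qnbWeight q (s ^ 2) c i' * qnbWeight q (q ^ J)⁻¹ (q ^ J * (c * s * z)) j' := by
  set x : ℝ := -(c * s * z) with hx
  set A := qnbWeight q (s ^ 2) c with hA
  set B := qnbWeight q (q ^ J)⁻¹ (q ^ J * (c * s * z)) with hB
  have hBj : ∀ j, j ≤ J → B j = x ^ j * qExchNorm q J j := fun j hj =>
    qnbWeight_inv_pow hq0 hq1 _ hj
  have h1 : ∀ p ∈ Finset.HasAntidiagonal.antidiagonal (i' + j'), A p.1 * B p.2 * fusedWeight q J z s p.1 p.2 i' j' =
      ∑ h' : Fin J → Fin 2, ∑ h : Fin J → Fin 2, if pathCount h = p.2 ∧ pathCount h' = j' then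
        A p.1 * arrangementWeight q x h * columnWeight q J z s p.1 h h' else 0 := by
    intro p hp
    rw [fusedWeight_eq q J z s (Finset.HasAntidiagonal.mem_antidiagonal.1 hp)]
    simp only [Finset.mul_sum]
    refine Finset.sum_congr rfl fun h' _ => Finset.sum_congr rfl fun h _ => ?_
    split_ifs with hc
    -- The normalisation in `B j` cancels that of the entry law, leaving independent edge weights `x
    -- q^k`.
    · rw [arrangementWeight_eq, hc.1, hBj _ (hc.1 ▸ pathCount_le h)]
      have := (qExchNorm_pos hq0 hq1 J p.2).ne'
      field_simp
    · rw [mul_zero]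
  rw [Finset.sum_congr rfl h1, Finset.sum_comm]
  have h2 : ∀ h' : Fin J → Fin 2, ∑ p ∈ Finset.HasAntidiagonal.antidiagonal (i' + j'), ∑ h : Fin J → Fin 2,
      (if pathCount h = p.2 ∧ pathCount h' = j' then
        A p.1 * arrangementWeight q x h * columnWeight q J z s p.1 h h' else 0) =
      A i' * if pathCount h' = j' then arrangementWeight q x h' else 0 := by
    intro h'
    by_cases hc : pathCount h' = j'
    · simp only [hc, and_true, if_true]
      have := columnStep_qnbWeight hq0 hq1 hs0 c h' hz 1 i'
      simp only [one_mul] at this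
      rw [mul_comm, ← this, columnStep, Finset.sum_comm]
      refine Finset.sum_congr rfl fun h _ => ?_
      rw [hc]
      split_ifs with hle
      · rw [Finset.sum_eq_single (i' + j' - pathCount h, pathCount h)]
        · simp [hA, hx]
        · rintro ⟨a, b⟩ hab hne
          rw [Finset.HasAntidiagonal.mem_antidiagonal] at hab
          rw [if_neg]
          rintro rfl
          simp only [] at hab
          exact hne (by rw [← hab]; simp)
        · intro hn
          exact absurd (Finset.HasAntidiagonal.mem_antidiagonal.2 (Nat.sub_add_cancel hle)) hn
      · refine Finset.sum_eq_zero fun p hp => ?_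
        rw [Finset.HasAntidiagonal.mem_antidiagonal] at hp
        rw [if_neg]
        omega
    · simp [hc]
  rw [Finset.sum_congr rfl fun h' _ => h2 h', ← Finset.mul_sum]
  rcases Nat.lt_or_ge J j' with hlt | hge
  · rw [hB, qnbWeight_inv_pow_eq_zero hq0 _ hlt, Finset.sum_eq_zero]
    intro h' _
    rw [if_neg]
    have := pathCount_le h'
    omega
  · rw [sum_arrangementWeight hq0 hq1 J j' hge, hBj j' hge]

/-! ### Positivity of the fused weights -/

/-- The arrangement in which the first `j` edges are occupied. -/
def packed (J j : ℕ) : Fin J → Fin 2 := fun k => if (k : ℕ) < j then 1 else 0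

lemma sum_packed {J j : ℕ} (k : ℕ) (hk : k ≤ J) :
    (∑ l : Fin J, if (l : ℕ) < k then (packed J j l : ℕ) else 0) = min k j := by
  have : ∀ l : Fin J, (if (l : ℕ) < k then (packed J j l : ℕ) else 0) =
      if (l : ℕ) < min k j then 1 else 0 := by
    intro l
    simp only [packed, lt_min_iff]
    split_ifs <;> simp_all
  simp only [this]
  rw [Fin.sum_univ_eq_sum_range (fun l => if l < min k j then 1 else 0), Finset.sum_boole]
  have : Finset.filter (fun l => l < min k j) (Finset.range J) = Finset.range (min k j) := by
    ext l
    simp only [Finset.mem_filter, Finset.mem_range]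
    omega
  simp only [this, Finset.card_range, Nat.cast_id]

lemma pathCount_packed {J j : ℕ} (hj : j ≤ J) : pathCount (packed J j) = j := by
  have := sum_packed (J := J) (j := j) J le_rfl
  simpa [pathCount, hj] using this

/-- All terms are nonnegative, and the term with both arrangements packed at the bottom is positive:
the height `i + min k j - min k j'` is never truncated, since `j' ≤ i + j`. -/
theorem fusedWeight_pos {q s z : ℝ} (hq0 : 0 < q) (hq1 : q < 1) (hs0 : 0 < s) (hs1 : s < 1)
    (hz : z < 0) {J i j i' j' : ℕ} (h : i + j = i' + j') (hj : j ≤ J) (hj' : j' ≤ J) :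
    0 < fusedWeight q J z s i j i' j' := by
  have hzk : ∀ k : ℕ, q ^ k * z < 0 := fun k => mul_neg_of_pos_of_neg (pow_pos hq0 k) hz
  have hZ := qExchNorm_pos hq0 hq1 J j
  have hnn : ∀ g g' : Fin J → Fin 2, 0 ≤ (if pathCount g = j ∧ pathCount g' = j' then
        q ^ (∑ k : Fin J, (k : ℕ) * (g k : ℕ)) / qExchNorm q J j * columnWeight q J z s i g g'
      else 0) := by
    intro g g'
    split_ifs
    · refine mul_nonneg (by positivity) (Finset.prod_nonneg fun k _ => ?_)
      exact vertexWeight_nonneg hq0 hq1 hs0 hs1 (hzk _) _ _ (fin_two_coe_le _) (fin_two_coe_le _)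
    · exact le_rfl
  rw [fusedWeight_eq q J z s h]
  refine Finset.sum_pos' (fun g' _ => Finset.sum_nonneg fun g _ => hnn g g')
    ⟨packed J j', Finset.mem_univ _, Finset.sum_pos' (fun g _ => hnn g _)
      ⟨packed J j, Finset.mem_univ _, ?_⟩⟩
  rw [if_pos ⟨pathCount_packed hj, pathCount_packed hj'⟩]
  refine mul_pos (by positivity) (Finset.prod_pos fun k _ => ?_)
  refine vertexWeight_pos hq0 hq1 hs0 hs1 (hzk _) ?_ (fin_two_coe_le _) (fin_two_coe_le _)
  have hk := k.isLt
  simp only [columnHeight, sum_packed _ hk.le, sum_packed _ (Nat.succ_le_of_lt hk)]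
  simp only [packed]
  split_ifs <;> simp <;> omega

/-! ### Infinite q-Pochhammer symbols and the q-binomial theorem -/

lemma summable_norm_neg_mul_pow {q : ℝ} (hq0 : 0 < q) (hq1 : q < 1) (z : ℝ) :
    Summable fun k : ℕ => ‖-(z * q ^ k)‖ := by
  simp only [norm_neg, norm_mul]
  refine Summable.mul_left _ ?_
  simpa [abs_of_pos hq0] using summable_geometric_of_lt_one hq0.le hq1

lemma tendsto_qPoch {q : ℝ} (hq0 : 0 < q) (hq1 : q < 1) (z : ℝ) :
    Filter.Tendsto (qPoch q z) Filter.atTop (nhds (qPochInf q z)) := by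
  have h := multipliable_one_add_of_summable (summable_norm_neg_mul_pow hq0 hq1 z)
  have h' := h.hasProd.tendsto_prod_nat
  simp only [← sub_eq_add_neg] at h'
  exact h'

lemma one_sub_mul_pow_pos {q z : ℝ} (hq0 : 0 < q) (hq1 : q < 1) (hz : z < 1) (k : ℕ) :
    0 < 1 - z * q ^ k := by
  have h1 : q ^ k ≤ 1 := pow_le_one₀ hq0.le hq1.le
  have h2 : 0 < q ^ k := pow_pos hq0 k
  nlinarith

lemma qPochInf_pos {q z : ℝ} (hq0 : 0 < q) (hq1 : q < 1) (hz : z < 1) : 0 < qPochInf q z := by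
  have h := tprod_one_add_ne_zero_of_summable
    (fun k => by rw [← sub_eq_add_neg]; exact (one_sub_mul_pow_pos hq0 hq1 hz k).ne')
    (summable_norm_neg_mul_pow hq0 hq1 z)
  simp only [← sub_eq_add_neg] at h
  exact lt_of_le_of_ne (ge_of_tendsto' (tendsto_qPoch hq0 hq1 z)
    fun n => (qPoch_pos hq0 hq1 hz n).le) (Ne.symm h)

lemma qPoch_antitone {q z : ℝ} (hq0 : 0 < q) (hq1 : q < 1) (hz0 : 0 ≤ z) (hz : z < 1) :
    Antitone (qPoch q z) := by
  refine antitone_nat_of_succ_le fun n => ?_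
  rw [qPoch_succ]
  refine mul_le_of_le_one_right (qPoch_pos hq0 hq1 hz n).le ?_
  have : 0 ≤ z * q ^ n := by positivity
  linarith

/-- A summable sequence of q-negative binomial weights with `0 < β < 1` has `p < 1`. -/
lemma lt_one_of_summable_qnbWeight {q β p : ℝ} (hq0 : 0 < q) (hq1 : q < 1) (hβ0 : 0 ≤ β)
    (hβ1 : β < 1) (h : Summable (qnbWeight q β p)) : p < 1 := by
  by_contra! hp
  have hβ := qPochInf_pos hq0 hq1 hβ1
  -- For `p ≥ 1` the weights stay above `(β;q)_∞ > 0`, so they cannot tend to zero.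
  have hle : ∀ n, qPochInf q β ≤ qnbWeight q β p n := by
    intro n
    have h1 : qPochInf q β ≤ qPoch q β n := (qPoch_antitone hq0 hq1 hβ0 hβ1).le_of_tendsto
      (tendsto_qPoch hq0 hq1 β) n
    have h2 : 0 < qPoch q q n := qPoch_pos hq0 hq1 hq1 n
    have h3 : qPoch q q n ≤ 1 := by
      have := qPoch_antitone hq0 hq1 hq0.le hq1 (Nat.zero_le n)
      rwa [qPoch_zero] at this
    calc qPochInf q β ≤ qPoch q β n := h1
      _ ≤ qPoch q β n / qPoch q q n := le_div_self (hβ.le.trans h1) h2 h3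
      _ ≤ qnbWeight q β p n :=
        le_mul_of_one_le_left (div_nonneg (hβ.le.trans h1) h2.le) (one_le_pow₀ hp)
  exact absurd (ge_of_tendsto' h.tendsto_atTop_zero hle) (not_le.2 hβ)

/-- The q-binomial theorem, at an argument where the series converges absolutely. -/
theorem tsum_qnbWeight_mul {q β p : ℝ} (hq0 : 0 < q) (hq1 : q < 1)
    (h : Summable (qnbWeight q β p)) :
    (∑' n, qnbWeight q β p n) * qPochInf q p = qPochInf q (p * β) := by
  have hpow : ∀ k n, qnbWeight q β (p * q ^ k) n = (q ^ k) ^ n * qnbWeight q β p n := by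
    intro k n
    rw [mul_comm p, qnbWeight_mul]
  have hsum : ∀ k, Summable (qnbWeight q β (p * q ^ k)) := by
    intro k
    refine h.norm.of_norm_bounded fun n => ?_
    rw [hpow, norm_mul, norm_pow, norm_pow, Real.norm_of_nonneg hq0.le]
    exact mul_le_of_le_one_left (norm_nonneg _)
      (pow_le_one₀ (by positivity) (pow_le_one₀ hq0.le hq1.le))
  -- The series at `p q^k`. Its functional equation is iterated in `k`, and `F k → 1` because only
  -- the constant term survives at argument zero.
  set F : ℕ → ℝ := fun k => ∑' n, qnbWeight q β (p * q ^ k) n with hF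
  have hrec : ∀ k, (1 - p * q ^ k) * F k = (1 - p * β * q ^ k) * F (k + 1) := by
    intro k
    have e1 : ∀ n, qnbWeight q β (p * q ^ k) (n + 1) - qnbWeight q β (p * q ^ (k + 1)) (n + 1) =
        p * q ^ k * qnbWeight q β (p * q ^ k) n -
          p * β * q ^ k * qnbWeight q β (p * q ^ (k + 1)) n := by
      intro n
      have h1 := qnbWeight_succ hq0 hq1 β (p * q ^ k) n
      have e : ∀ m, qnbWeight q β (p * q ^ (k + 1)) m = q ^ m * qnbWeight q β (p * q ^ k) m := by
        intro m
        rw [hpow, hpow]; ring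
      rw [e, e]
      linear_combination h1
    have e2 := (hsum k).tsum_eq_zero_add
    have e3 := (hsum (k + 1)).tsum_eq_zero_add
    have s1 := (summable_nat_add_iff 1).2 (hsum k)
    have s2 := (summable_nat_add_iff 1).2 (hsum (k + 1))
    have e4 := s1.tsum_sub s2
    simp only [e1] at e4
    rw [((hsum k).mul_left _).tsum_sub ((hsum (k + 1)).mul_left _), tsum_mul_left,
      tsum_mul_left] at e4
    rw [qnbWeight_zero] at e2 e3
    simp only [hF]
    linear_combination e2 - e3 - e4
  have hiter : ∀ k, F 0 * qPoch q p k = F k * qPoch q (p * β) k := by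
    intro k
    induction k with
    | zero => simp [qPoch_zero]
    | succ k ih =>
      rw [qPoch_succ, qPoch_succ]
      linear_combination (1 - p * q ^ k) * ih + qPoch q (p * β) k * hrec k
  have hlim : Filter.Tendsto F Filter.atTop (nhds 1) := by
    rw [tendsto_iff_norm_sub_tendsto_zero]
    have hb : ∀ k, ‖F k - 1‖ ≤ q ^ k * ∑' n, ‖qnbWeight q β p (n + 1)‖ := by
      intro k
      have e2 := (hsum k).tsum_eq_zero_add
      rw [qnbWeight_zero] at e2
      have : F k - 1 = ∑' n, qnbWeight q β (p * q ^ k) (n + 1) := by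
        simp only [hF]; linarith
      rw [this, ← tsum_mul_left]
      have hs := ((summable_nat_add_iff 1).2 h.norm).mul_left (q ^ k)
      refine tsum_of_norm_bounded hs.hasSum fun n => ?_
      rw [hpow, norm_mul, norm_pow, norm_pow, Real.norm_of_nonneg hq0.le]
      refine mul_le_mul_of_nonneg_right ?_ (norm_nonneg _)
      exact pow_le_of_le_one (by positivity) (pow_le_one₀ hq0.le hq1.le) (Nat.succ_ne_zero n)
    refine squeeze_zero (fun k => norm_nonneg _) hb ?_
    have := (tendsto_pow_atTop_nhds_zero_of_lt_one hq0.le hq1).mul_const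
      (∑' n, ‖qnbWeight q β p (n + 1)‖)
    simpa using this
  have h1 := (tendsto_qPoch hq0 hq1 p).const_mul (F 0)
  have h2 := hlim.mul (tendsto_qPoch hq0 hq1 (p * β))
  simp only [hiter] at h1
  have := tendsto_nhds_unique h1 h2
  simpa [hF] using this

/-- A probability mass function proportional to the q-negative binomial weights is the
q-negative binomial law. -/
lemma eq_qnb_of_hasSum {q β p a : ℝ} (hq0 : 0 < q) (hq1 : q < 1) (hp : p * β < 1)
    (hsum : HasSum (fun n => a * qnbWeight q β p n) 1) :
    a = qPochInf q p / qPochInf q (p * β) := by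
  have ha : a ≠ 0 := by
    rintro rfl
    simp only [zero_mul] at hsum
    exact zero_ne_one (hasSum_zero.unique hsum)
  have hs : Summable (qnbWeight q β p) := (summable_mul_left_iff ha).1 hsum.summable
  have h1 : a * ∑' n, qnbWeight q β p n = 1 := by rw [← tsum_mul_left]; exact hsum.tsum_eq
  have h2 := tsum_qnbWeight_mul hq0 hq1 hs
  rw [eq_div_iff (qPochInf_pos hq0 hq1 hp).ne', ← h2, ← mul_assoc, h1, one_mul]

/-! ### Entropy production and rigidity of marginally stationary products -/

/-- Entropy production of a finite Markov kernel `M` with positive stationary weight `R`, tested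
against the density `r`: it is nonnegative. -/
lemma entropy_production_nonneg {α : Type*} (S : Finset α) (R r : α → ℝ) (M : α → α → ℝ)
    (hR : ∀ x ∈ S, 0 < R x) (hr : ∀ x ∈ S, 0 < r x) (hM : ∀ x ∈ S, ∀ y ∈ S, 0 < M x y)
    (hstat : ∀ y ∈ S, ∑ x ∈ S, R x * M x y = R y) (hone : ∀ x ∈ S, ∑ y ∈ S, M x y = 1) :
    0 ≤ ∑ y ∈ S, (R y * r y - ∑ x ∈ S, R x * r x * M x y) * Real.log (r y) ∧
    ((∑ y ∈ S, (R y * r y - ∑ x ∈ S, R x * r x * M x y) * Real.log (r y)) = 0 →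
      ∀ x ∈ S, ∀ y ∈ S, r x = r y) := by
  -- The summand is positive unless `r x = r y`, by strictness of `log t ≤ t - 1`. The correction `r
  -- x - r y` is free: stationarity and unit row sums make its weighted sum vanish.
  set E : α → α → ℝ := fun x y =>
    R x * M x y * (r x * (Real.log (r x) - Real.log (r y)) - (r x - r y)) with hE
  have key : ∀ a b : ℝ, 0 < a → 0 < b → a ≠ b → 0 < a * (Real.log a - Real.log b) - (a - b) := by
    intro a b ha hb hab
    have hne : b / a ≠ 1 := fun h => hab ((div_eq_one_iff_eq ha.ne').1 h).symm
    have h1 := Real.log_lt_sub_one_of_pos (div_pos hb ha) hne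
    rw [Real.log_div hb.ne' ha.ne'] at h1
    have h2 := mul_lt_mul_of_pos_left h1 ha
    have h3 : a * (b / a - 1) = b - a := by field_simp
    rw [h3] at h2
    linarith
  have hEnn : ∀ x ∈ S, ∀ y ∈ S, 0 ≤ E x y := by
    intro x hx y hy
    refine mul_nonneg (mul_pos (hR x hx) (hM x hx y hy)).le ?_
    rcases eq_or_ne (r x) (r y) with h | h
    · rw [h]; simp
    · exact (key _ _ (hr x hx) (hr y hy) h).le
  have hsum : ∑ y ∈ S, (R y * r y - ∑ x ∈ S, R x * r x * M x y) * Real.log (r y) =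
      ∑ x ∈ S, ∑ y ∈ S, E x y := by
    have a1 : ∑ x ∈ S, ∑ y ∈ S, R x * M x y * (r x * Real.log (r x)) =
        ∑ x ∈ S, R x * r x * Real.log (r x) := by
      refine Finset.sum_congr rfl fun x hx => ?_
      have : ∀ y, R x * M x y * (r x * Real.log (r x)) = R x * r x * Real.log (r x) * M x y :=
        fun y => by ring
      simp only [this, ← Finset.mul_sum, hone x hx, mul_one]
    have a2 : ∑ x ∈ S, ∑ y ∈ S, R x * M x y * r x = ∑ x ∈ S, R x * r x := by
      refine Finset.sum_congr rfl fun x hx => ?_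
      have : ∀ y, R x * M x y * r x = R x * r x * M x y := fun y => by ring
      simp only [this, ← Finset.mul_sum, hone x hx, mul_one]
    have a3 : ∑ x ∈ S, ∑ y ∈ S, R x * M x y * r y = ∑ x ∈ S, R x * r x := by
      rw [Finset.sum_comm]
      refine Finset.sum_congr rfl fun y hy => ?_
      rw [← Finset.sum_mul, hstat y hy]
    have a4 : ∑ x ∈ S, ∑ y ∈ S, R x * M x y * (r x * Real.log (r y)) =
        ∑ y ∈ S, (∑ x ∈ S, R x * r x * M x y) * Real.log (r y) := by
      rw [Finset.sum_comm]
      refine Finset.sum_congr rfl fun y _ => ?_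
      rw [Finset.sum_mul]
      refine Finset.sum_congr rfl fun x _ => ?_
      ring
    have a5 : ∑ x ∈ S, ∑ y ∈ S, E x y =
        ∑ x ∈ S, ∑ y ∈ S, R x * M x y * (r x * Real.log (r x)) -
        ∑ x ∈ S, ∑ y ∈ S, R x * M x y * (r x * Real.log (r y)) -
        (∑ x ∈ S, ∑ y ∈ S, R x * M x y * r x - ∑ x ∈ S, ∑ y ∈ S, R x * M x y * r y) := by
      simp only [← Finset.sum_sub_distrib]
      refine Finset.sum_congr rfl fun x _ => Finset.sum_congr rfl fun y _ => ?_
      simp only [hE]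
      ring
    rw [a5, a1, a2, a3, a4, sub_self, sub_zero, ← Finset.sum_sub_distrib]
    refine Finset.sum_congr rfl fun y _ => ?_
    ring
  rw [hsum]
  have hnn : ∀ x ∈ S, 0 ≤ ∑ y ∈ S, E x y := fun x hx => Finset.sum_nonneg (hEnn x hx)
  refine ⟨Finset.sum_nonneg hnn, fun h0 x hx y hy => ?_⟩
  have h1 := (Finset.sum_eq_zero_iff_of_nonneg hnn).1 h0 x hx
  have h2 := (Finset.sum_eq_zero_iff_of_nonneg (hEnn x hx)).1 h1 y hy
  by_contra hne
  exact (mul_pos (mul_pos (hR x hx) (hM x hx y hy)) (key _ _ (hr x hx) (hr y hy) hne)).ne' h2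

/-- Window sums of `(i + 1) b_i` with `b` summable are not bounded away from `0`. -/
lemma not_eventually_le_window_sum {b : ℕ → ℝ} (hb0 : ∀ i, 0 ≤ b i) (hb : Summable b) (J : ℕ)
    {ε : ℝ} (hε : 0 < ε) :
    ¬ ∀ᶠ K in Filter.atTop, ε ≤ ∑ i ∈ Finset.Ico (K - J) K, ((i : ℝ) + 1) * b i := by
  intro h
  obtain ⟨K0, hK0⟩ := Filter.eventually_atTop.1 h
  have hs : Summable fun n : ℕ => ∑ l ∈ Finset.range J, b (n + K0 + l) := by
    refine summable_sum fun l _ => ?_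
    have := (summable_nat_add_iff (K0 + l)).2 hb
    simpa only [add_assoc] using this
  -- On the window below `n + K0 + J` the factor `i + 1` is at most `n + K0 + J + 1`, so a lower
  -- bound `ε` would make a summable series dominate the harmonic one.
  have hle : ∀ n : ℕ, ε * ((n + (K0 + J + 1) : ℕ) : ℝ)⁻¹ ≤
      ∑ l ∈ Finset.range J, b (n + K0 + l) := by
    intro n
    have h1 := hK0 (n + K0 + J) (by omega)
    have h2 : ∑ i ∈ Finset.Ico (n + K0 + J - J) (n + K0 + J), ((i : ℝ) + 1) * b i ≤
        ((n + (K0 + J + 1) : ℕ) : ℝ) * ∑ l ∈ Finset.range J, b (n + K0 + l) := by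
      rw [Nat.add_sub_cancel, Finset.sum_Ico_eq_sum_range, Nat.add_sub_cancel_left, Finset.mul_sum]
      refine Finset.sum_le_sum fun l hl => ?_
      refine mul_le_mul_of_nonneg_right ?_ (hb0 _)
      have := Finset.mem_range.1 hl
      exact_mod_cast (by omega : n + K0 + l + 1 ≤ n + (K0 + J + 1))
    have hpos : (0 : ℝ) < ((n + (K0 + J + 1) : ℕ) : ℝ) := by positivity
    rw [← div_eq_mul_inv, div_le_iff₀ hpos, mul_comm]
    exact h1.trans h2
  have h3 : Summable fun n : ℕ => ε * ((n + (K0 + J + 1) : ℕ) : ℝ)⁻¹ :=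
    hs.of_nonneg_of_le (fun n => by positivity) hle
  rw [summable_mul_left_iff hε.ne',
    summable_nat_add_iff (f := fun n : ℕ => ((n : ℝ))⁻¹)] at h3
  exact Real.not_summable_natCast_inv h3

/-- This is `log t ≤ t - 1` at `t = exp (-c) / x`. Taken with `c = i`, it bounds `P i * |log (P i)|`
by `i * P i` plus a summable term, although `P` may have infinite mean or entropy. -/
lemma mul_abs_log_le {x : ℝ} (hx0 : 0 < x) (hx1 : x ≤ 1) (c : ℝ) :
    x * |Real.log x| ≤ c * x + Real.exp (-c) := by
  rw [abs_of_nonpos (Real.log_nonpos hx0.le hx1)]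
  have h := Real.log_le_sub_one_of_pos (div_pos (Real.exp_pos (-c)) hx0)
  rw [Real.log_div (Real.exp_pos _).ne' hx0.ne', Real.log_exp] at h
  have h2 := mul_le_mul_of_nonneg_left h hx0.le
  have h3 : x * (Real.exp (-c) / x - 1) = Real.exp (-c) - x := by field_simp
  rw [h3] at h2
  linarith

/-- Summing `G` over `{i + j < K, j ≤ J}` level by level. -/
lemma sum_triangle_succ (J : ℕ) (G : ℕ → ℕ → ℝ) (K : ℕ) :
    ∑ j ∈ Finset.range (J + 1), ∑ i ∈ Finset.range (K + 1 - j), G i j =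
      ∑ j ∈ Finset.range (J + 1), ∑ i ∈ Finset.range (K - j), G i j +
        ∑ j ∈ (Finset.range (J + 1)).filter (· ≤ K), G (K - j) j := by
  rw [Finset.sum_filter, ← Finset.sum_add_distrib]
  refine Finset.sum_congr rfl fun j _ => ?_
  split_ifs with h
  · rw [Nat.succ_sub h, Finset.sum_range_succ]
  · rw [show K + 1 - j = 0 by omega, show K - j = 0 by omega]
    simp

/-- If the sums of `D i j * (f i + g j)` over each level `i + j = N` are nonnegative, both marginals
of `D` vanish and `∑_j |D i j| |f i|` is at most `(i + 1) b_i` with `b` summable, then they all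
vanish. -/
lemma level_sum_eq_zero (J : ℕ) (D : ℕ → ℕ → ℝ) (f g b : ℕ → ℝ) (hb : Summable b)
    (hfb : ∀ i, (∑ j ∈ Finset.range (J + 1), |D i j|) * |f i| ≤ ((i : ℝ) + 1) * b i)
    (hD1 : ∀ i, ∑ j ∈ Finset.range (J + 1), D i j = 0)
    (hD2 : ∀ j ≤ J, HasSum (fun i => D i j) 0)
    (hlevel : ∀ N, 0 ≤ ∑ j ∈ (Finset.range (J + 1)).filter (· ≤ N),
      D (N - j) j * (f (N - j) + g j)) (N : ℕ) :
    ∑ j ∈ (Finset.range (J + 1)).filter (· ≤ N), D (N - j) j * (f (N - j) + g j) = 0 := by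
  have hb0 : ∀ i, 0 ≤ b i := by
    intro i
    have h1 : 0 ≤ ((i : ℝ) + 1) * b i :=
      le_trans (mul_nonneg (Finset.sum_nonneg fun _ _ => abs_nonneg _) (abs_nonneg _)) (hfb i)
    exact nonneg_of_mul_nonneg_right h1 (by positivity)
  by_contra hne
  set δ := ∑ j ∈ (Finset.range (J + 1)).filter (· ≤ N), D (N - j) j * (f (N - j) + g j) with hδ
  have hδ0 : 0 < δ := lt_of_le_of_ne (hlevel N) (Ne.symm hne)
  -- The sum over the triangle `i + j < K`. It is nondecreasing in `K`, so one positive level keeps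
  -- it above `δ`.
  set T : ℕ → ℝ := fun K => ∑ j ∈ Finset.range (J + 1), ∑ i ∈ Finset.range (K - j),
    D i j * (f i + g j) with hT
  have hTsucc := sum_triangle_succ J fun i j => D i j * (f i + g j)
  have hTmono : Monotone T := monotone_nat_of_le_succ fun K => by
    simp only [hT]
    rw [hTsucc K]
    exact le_add_of_nonneg_right (hlevel K)
  have hT0 : T 0 = 0 := by simp [hT]
  have hTge : ∀ K, N + 1 ≤ K → δ ≤ T K := by
    intro K hK
    refine le_trans ?_ (hTmono hK)
    have h1 : T (N + 1) = T N + δ := hTsucc N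
    have h2 : T 0 ≤ T N := hTmono (Nat.zero_le N)
    linarith
  -- The contribution of `g`, which tends to zero because each column sum of `D` vanishes.
  set U : ℕ → ℝ := fun K => ∑ j ∈ Finset.range (J + 1), g j * ∑ i ∈ Finset.range (K - j), D i j
    with hU
  have hUlim : Filter.Tendsto U Filter.atTop (nhds 0) := by
    have : Filter.Tendsto U Filter.atTop (nhds (∑ j ∈ Finset.range (J + 1), g j * 0)) := by
      refine tendsto_finsetSum _ fun j hj => Filter.Tendsto.const_mul _ ?_
      have hj' : j ≤ J := Nat.lt_succ_iff.1 (Finset.mem_range.1 hj)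
      exact (hD2 j hj').tendsto_sum_nat.comp (Filter.tendsto_sub_atTop_nat j)
    simpa using this
  have hTU : ∀ K, T K ≤ U K + ∑ i ∈ Finset.Ico (K - J) K, ((i : ℝ) + 1) * b i := by
    intro K
    have h1 : T K = U K + ∑ j ∈ Finset.range (J + 1), ∑ i ∈ Finset.range (K - j), D i j * f i := by
      simp only [hT, hU, ← Finset.sum_add_distrib, Finset.mul_sum]
      refine Finset.sum_congr rfl fun j _ => Finset.sum_congr rfl fun i _ => ?_
      ring
    have h2 : ∑ j ∈ Finset.range (J + 1), ∑ i ∈ Finset.range K, D i j * f i = 0 := by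
      rw [Finset.sum_comm]
      refine Finset.sum_eq_zero fun i _ => ?_
      rw [← Finset.sum_mul, hD1 i, zero_mul]
    -- Full rows of `D` contribute nothing to the `f` part, so only the strip `K - j ≤ i < K` that
    -- the triangle misses remains. It has bounded width `J`.
    have h3 : ∑ j ∈ Finset.range (J + 1), ∑ i ∈ Finset.range (K - j), D i j * f i =
        ∑ j ∈ Finset.range (J + 1), -∑ i ∈ Finset.Ico (K - j) K, D i j * f i := by
      rw [← sub_zero (∑ j ∈ Finset.range (J + 1), ∑ i ∈ Finset.range (K - j), D i j * f i), ← h2,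
        ← Finset.sum_sub_distrib]
      refine Finset.sum_congr rfl fun j _ => ?_
      rw [Finset.sum_Ico_eq_sub _ (Nat.sub_le K j)]
      ring
    rw [h1, h3]
    refine add_le_add le_rfl ?_
    calc ∑ j ∈ Finset.range (J + 1), -∑ i ∈ Finset.Ico (K - j) K, D i j * f i
        ≤ ∑ j ∈ Finset.range (J + 1), ∑ i ∈ Finset.Ico (K - J) K, |D i j| * |f i| := by
          refine Finset.sum_le_sum fun j hj => ?_
          have hj' : j ≤ J := Nat.lt_succ_iff.1 (Finset.mem_range.1 hj)
          calc -∑ i ∈ Finset.Ico (K - j) K, D i j * f i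
              ≤ |∑ i ∈ Finset.Ico (K - j) K, D i j * f i| := neg_le_abs _
            _ ≤ ∑ i ∈ Finset.Ico (K - j) K, |D i j * f i| := Finset.abs_sum_le_sum_abs _ _
            _ ≤ ∑ i ∈ Finset.Ico (K - J) K, |D i j * f i| :=
                Finset.sum_le_sum_of_subset_of_nonneg
                  (Finset.Ico_subset_Ico (by omega) le_rfl) fun _ _ _ => abs_nonneg _
            _ = ∑ i ∈ Finset.Ico (K - J) K, |D i j| * |f i| := by simp only [abs_mul]
      _ = ∑ i ∈ Finset.Ico (K - J) K, (∑ j ∈ Finset.range (J + 1), |D i j|) * |f i| := by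
          rw [Finset.sum_comm]
          simp only [Finset.sum_mul]
      _ ≤ _ := Finset.sum_le_sum fun i _ => hfb i
  refine not_eventually_le_window_sum hb0 hb J (half_pos hδ0) ?_
  filter_upwards [Filter.eventually_ge_atTop (N + 1), hUlim.eventually_lt_const (half_pos hδ0)]
    with K hK1 hK2
  have h1 := hTge K hK1
  have h2 := hTU K
  linarith

/-- Marginal stationarity of a product density under a conservative kernel with stationary weight
`A ⊗ B` forces the density relative to `A ⊗ B` to depend only on the conserved quantity. -/
theorem density_const_on_levels (J : ℕ) (P P' A B : ℕ → ℝ) (M : ℕ → ℕ → ℕ → ℕ → ℝ)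
    (Q : ℕ → ℕ → ℝ) (C : ℝ)
    (hP : ∀ i, 0 < P i) (hP1 : ∀ i, P i ≤ 1) (hPs : Summable P) (hP' : ∀ j ≤ J, 0 < P' j)
    (hP's : ∑ j ∈ Finset.range (J + 1), P' j = 1)
    (hA : ∀ i, 0 < A i) (hAlog : ∀ i : ℕ, |Real.log (A i)| ≤ C * ((i : ℝ) + 1))
    (hB : ∀ j ≤ J, 0 < B j)
    (hM : ∀ i j i' j', i + j = i' + j' → j ≤ J → j' ≤ J → 0 < M i j i' j')
    (hstat : ∀ N, ∀ j' ≤ J, j' ≤ N → ∑ j ∈ (Finset.range (J + 1)).filter (· ≤ N),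
      A (N - j) * B j * M (N - j) j (N - j') j' = A (N - j') * B j')
    (hone : ∀ N, ∀ j ≤ J, j ≤ N → ∑ j' ∈ (Finset.range (J + 1)).filter (· ≤ N),
      M (N - j) j (N - j') j' = 1)
    (hQ : ∀ N, ∀ j' ≤ J, j' ≤ N → Q (N - j') j' = ∑ j ∈ (Finset.range (J + 1)).filter (· ≤ N),
      P (N - j) * P' j * M (N - j) j (N - j') j')
    (hQ0 : ∀ i j, 0 ≤ Q i j)
    (hQ1 : ∀ i, ∑ j ∈ Finset.range (J + 1), Q i j = P i)
    (hQ2 : ∀ j ≤ J, HasSum (fun i => P i * P' j - Q i j) 0)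
    {i j i' j' : ℕ} (h : i + j = i' + j') (hj : j ≤ J) (hj' : j' ≤ J) :
    P i * P' j / (A i * B j) = P i' * P' j' / (A i' * B j') := by
  set f : ℕ → ℝ := fun i => Real.log (P i / A i) with hf
  set g : ℕ → ℝ := fun j => Real.log (P' j / B j) with hg
  set D : ℕ → ℕ → ℝ := fun i j => P i * P' j - Q i j with hD
  have hmem : ∀ {N k : ℕ}, k ∈ (Finset.range (J + 1)).filter (· ≤ N) → k ≤ J ∧ k ≤ N := by
    intro N k hk
    rw [Finset.mem_filter, Finset.mem_range] at hk
    exact ⟨Nat.lt_succ_iff.1 hk.1, hk.2⟩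
  have hlog : ∀ i j, j ≤ J → Real.log (P i * P' j / (A i * B j)) = f i + g j := by
    intro i j hj
    rw [mul_div_mul_comm, Real.log_mul (div_pos (hP i) (hA i)).ne' (div_pos (hP' j hj) (hB j hj)).ne']
  have hent := fun N => entropy_production_nonneg ((Finset.range (J + 1)).filter (· ≤ N))
    (fun k => A (N - k) * B k) (fun k => P (N - k) * P' k / (A (N - k) * B k))
    (fun k l => M (N - k) k (N - l) l)
    (fun k hk => mul_pos (hA _) (hB _ (hmem hk).1))
    (fun k hk => div_pos (mul_pos (hP _) (hP' _ (hmem hk).1)) (mul_pos (hA _) (hB _ (hmem hk).1)))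
    (fun k hk l hl => hM _ _ _ _ (by have := hmem hk; have := hmem hl; omega)
      (hmem hk).1 (hmem hl).1)
    (fun l hl => hstat N l (hmem hl).1 (hmem hl).2)
    (fun k hk => hone N k (hmem hk).1 (hmem hk).2)
  have hcancel : ∀ N k, k ≤ J →
      A (N - k) * B k * (P (N - k) * P' k / (A (N - k) * B k)) = P (N - k) * P' k := by
    intro N k hk
    rw [mul_div_cancel₀]
    exact (mul_pos (hA _) (hB _ hk)).ne'
  have heq : ∀ N, ∑ l ∈ (Finset.range (J + 1)).filter (· ≤ N),
      (A (N - l) * B l * (P (N - l) * P' l / (A (N - l) * B l)) -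
        ∑ k ∈ (Finset.range (J + 1)).filter (· ≤ N),
          A (N - k) * B k * (P (N - k) * P' k / (A (N - k) * B k)) * M (N - k) k (N - l) l) *
        Real.log (P (N - l) * P' l / (A (N - l) * B l)) =
      ∑ l ∈ (Finset.range (J + 1)).filter (· ≤ N), D (N - l) l * (f (N - l) + g l) := by
    intro N
    refine Finset.sum_congr rfl fun l hl => ?_
    obtain ⟨hl1, hl2⟩ := hmem hl
    rw [hlog _ _ hl1, hcancel N l hl1]
    simp only [hD]
    rw [hQ N l hl1 hl2]
    congr 2
    refine Finset.sum_congr rfl fun k hk => ?_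
    rw [hcancel N k (hmem hk).1]
  simp only [heq] at hent
  -- The bound `b` combines `∑_j |D i j| ≤ 2 P i`, the estimate of `P i * |log (P i)|` with `c = i`,
  -- and the linear growth of `log (A i)`.
  have hzero := level_sum_eq_zero J D f g
    (fun i => 2 * ((1 + |C|) * P i + Real.exp (-(i : ℝ))))
    (((hPs.mul_left _).add Real.summable_exp_neg_nat).mul_left _) ?_ ?_ hQ2 (fun N => (hent N).1)
  · have := (hent (i + j)).2 (hzero (i + j)) j
      (by rw [Finset.mem_filter, Finset.mem_range]; omega) j'
      (by rw [Finset.mem_filter, Finset.mem_range]; omega)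
    rwa [Nat.add_sub_cancel, h, Nat.add_sub_cancel] at this
  · intro i
    have h1 : ∑ j ∈ Finset.range (J + 1), |D i j| ≤ 2 * P i := by
      calc ∑ j ∈ Finset.range (J + 1), |D i j|
          ≤ ∑ j ∈ Finset.range (J + 1), (P i * P' j + Q i j) := by
            refine Finset.sum_le_sum fun j hj => ?_
            have hj' := hP' j (Nat.lt_succ_iff.1 (Finset.mem_range.1 hj))
            have hpp := mul_pos (hP i) hj'
            have hq := hQ0 i j
            simp only [hD]
            rw [abs_le]
            constructor <;> linarith
        _ = 2 * P i := by
            rw [Finset.sum_add_distrib, ← Finset.mul_sum, hP's, hQ1]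
            ring
    have h2 : P i * |f i| ≤ ((i : ℝ) + 1) * ((1 + |C|) * P i + Real.exp (-(i : ℝ))) := by
      have e1 : |f i| ≤ |Real.log (P i)| + |Real.log (A i)| := by
        simp only [hf]
        rw [Real.log_div (hP i).ne' (hA i).ne']
        exact abs_sub _ _
      have e2 := mul_abs_log_le (hP i) (hP1 i) (i : ℝ)
      have e3 : |Real.log (A i)| ≤ |C| * ((i : ℝ) + 1) :=
        (hAlog i).trans (mul_le_mul_of_nonneg_right (le_abs_self C) (by positivity))
      have e4 := mul_le_mul_of_nonneg_left e1 (hP i).le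
      have e5 := mul_le_mul_of_nonneg_left e3 (hP i).le
      have e6 : 0 ≤ (i : ℝ) * Real.exp (-(i : ℝ)) := by positivity
      have e7 := (hP i)
      nlinarith
    calc (∑ j ∈ Finset.range (J + 1), |D i j|) * |f i| ≤ 2 * P i * |f i| :=
          mul_le_mul_of_nonneg_right h1 (abs_nonneg _)
      _ = 2 * (P i * |f i|) := by ring
      _ ≤ 2 * (((i : ℝ) + 1) * ((1 + |C|) * P i + Real.exp (-(i : ℝ)))) := by linarith
      _ = ((i : ℝ) + 1) * (2 * ((1 + |C|) * P i + Real.exp (-(i : ℝ)))) := by ring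
  · intro i
    simp only [hD]
    rw [Finset.sum_sub_distrib, ← Finset.mul_sum, hP's, hQ1, mul_one, sub_self]

/-- The logarithms of the q-negative binomial weights grow at most linearly. -/
lemma exists_abs_log_qnbWeight_le {q β p : ℝ} (hq0 : 0 < q) (hq1 : q < 1) (hβ0 : 0 ≤ β)
    (hβ1 : β < 1) (hp : 0 < p) :
    ∃ C : ℝ, ∀ i : ℕ, |Real.log (qnbWeight q β p i)| ≤ C * ((i : ℝ) + 1) := by
  -- Each step of the recursion moves the logarithm by at most `c`, since `1 - β q^n` lies in `[1 -
  -- β, 1]` and `1 - q^(n+1)` in `[1 - q, 1]`.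
  set c : ℝ := |Real.log p| + |Real.log (1 - β)| + |Real.log (1 - q)| with hc
  refine ⟨c, fun i => ?_⟩
  have hc0 : 0 ≤ c := by positivity
  suffices h : |Real.log (qnbWeight q β p i)| ≤ c * i by nlinarith
  have hmono : ∀ x y : ℝ, 0 < x → x ≤ y → y ≤ 1 → |Real.log y| ≤ |Real.log x| := by
    intro x y hx hxy hy
    rw [abs_of_nonpos (Real.log_nonpos (hx.le.trans hxy) hy),
      abs_of_nonpos (Real.log_nonpos hx.le (hxy.trans hy))]
    exact neg_le_neg (Real.log_le_log hx hxy)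
  induction i with
  | zero => simp [qnbWeight_zero]
  | succ n ih =>
    have hqn : q ^ n ≤ 1 := pow_le_one₀ hq0.le hq1.le
    have hqn0 : 0 < q ^ n := pow_pos hq0 n
    have hpos := qnbWeight_pos hq0 hq1 hβ1 hp n
    have hpos' := qnbWeight_pos hq0 hq1 hβ1 hp (n + 1)
    have h1 : 0 < 1 - β * q ^ n := one_sub_mul_pow_pos hq0 hq1 hβ1 n
    have h2 := one_sub_pow_succ_pos hq0 hq1 n
    have hlog := congrArg Real.log (qnbWeight_succ hq0 hq1 β p n)
    rw [Real.log_mul hpos'.ne' h2.ne', Real.log_mul hpos.ne' (mul_pos hp h1).ne',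
      Real.log_mul hp.ne' h1.ne'] at hlog
    have h3 : |Real.log (1 - β * q ^ n)| ≤ |Real.log (1 - β)| :=
      hmono _ _ (by linarith) (by nlinarith) (by nlinarith)
    have h4 : |Real.log (1 - q ^ (n + 1))| ≤ |Real.log (1 - q)| :=
      hmono _ _ (by linarith) (by rw [pow_succ]; nlinarith)
        (by have := pow_pos hq0 (n + 1); linarith)
    have h5 : Real.log (qnbWeight q β p (n + 1)) = Real.log (qnbWeight q β p n) + Real.log p +
        Real.log (1 - β * q ^ n) - Real.log (1 - q ^ (n + 1)) := by linarith
    rw [h5]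
    push_cast
    have a1 := abs_sub (Real.log (qnbWeight q β p n) + Real.log p + Real.log (1 - β * q ^ n))
      (Real.log (1 - q ^ (n + 1)))
    have a2 := abs_add_le (Real.log (qnbWeight q β p n) + Real.log p) (Real.log (1 - β * q ^ n))
    have a3 := abs_add_le (Real.log (qnbWeight q β p n)) (Real.log p)
    linarith

/-! ### Independence of discrete families through product masses -/

/-- Disintegration of an event over the values of a discrete random variable. -/
lemma hasSum_measureReal_inter_fiber {Ω : Type*} [MeasurableSpace Ω] (μ : Measure Ω)
    [IsFiniteMeasure μ] {A : Set Ω} (hA : MeasurableSet A) {X : Ω → ℕ} (hX : Measurable X) :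
    HasSum (fun n => μ.real (A ∩ {ω | X ω = n})) (μ.real A) := by
  have hmeas : ∀ n, MeasurableSet (A ∩ {ω | X ω = n}) :=
    fun n => hA.inter (hX (measurableSet_singleton n))
  have hdisj : Pairwise (Function.onFun Disjoint fun n => A ∩ {ω | X ω = n}) := by
    intro m n hmn
    refine Set.disjoint_left.2 fun ω h1 h2 => hmn ?_
    exact h1.2.symm.trans h2.2
  have hU : (⋃ n, A ∩ {ω | X ω = n}) = A := by
    ext ω
    simp
  have h1 := measure_iUnion (μ := μ) hdisj hmeas
  rw [hU] at h1
  have h2 : ∑' n, μ (A ∩ {ω | X ω = n}) ≠ ⊤ := h1 ▸ measure_ne_top μ A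
  have h3 := ENNReal.hasSum_toReal h2
  rw [← ENNReal.tsum_toReal_eq fun n => measure_ne_top μ _, ← h1] at h3
  exact h3

/-- The joint mass function of every finite subfamily of `Z` is the product of the `ρ i`. -/
def HasProductMass {Ω ι : Type*} [MeasurableSpace Ω] (μ : Measure Ω) (Z : ι → Ω → ℕ)
    (ρ : ι → ℕ → ℝ) : Prop :=
  ∀ (S : Finset ι) (v : ι → ℕ), μ.real {ω | ∀ i ∈ S, Z i ω = v i} = ∏ i ∈ S, ρ i (v i)

section

variable {Ω ι : Type*} [MeasurableSpace Ω] {μ : Measure Ω} {Z : ι → Ω → ℕ} {ρ : ι → ℕ → ℝ}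

lemma measurableSet_forall_mem_eq (hZ : ∀ i, Measurable (Z i)) (S : Finset ι) (v : ι → ℕ) :
    MeasurableSet {ω | ∀ i ∈ S, Z i ω = v i} := by
  have : {ω | ∀ i ∈ S, Z i ω = v i} = ⋂ i ∈ S, Z i ⁻¹' {v i} := by ext; simp
  rw [this]
  exact S.measurableSet_biInter fun i _ => hZ i (measurableSet_singleton _)

lemma HasProductMass.mass (h : HasProductMass μ Z ρ) (i : ι) (n : ℕ) :
    μ.real {ω | Z i ω = n} = ρ i n := by
  simpa using h {i} fun _ => n

lemma ProbabilityTheory.iIndepFun.hasProductMass (h : iIndepFun Z μ) :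
    HasProductMass μ Z fun i n => μ.real {ω | Z i ω = n} := by
  intro S v
  have h1 := h.measure_inter_preimage_eq_mul S (sets := fun i => {v i})
    fun i _ => measurableSet_singleton _
  have : {ω | ∀ i ∈ S, Z i ω = v i} = ⋂ i ∈ S, Z i ⁻¹' {v i} := by ext; simp
  rw [this, measureReal_def, h1, ENNReal.toReal_prod]
  rfl

lemma HasProductMass.iIndepFun [IsProbabilityMeasure μ] (hZ : ∀ i, Measurable (Z i))
    (h : HasProductMass μ Z ρ) : iIndepFun Z μ := by
  rw [iIndepFun_iff_finset]
  intro S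
  rw [iIndepFun_iff_map_fun_eq_pi_map (f := S.restrict Z) fun i => (hZ i).aemeasurable]
  have hmeas : Measurable fun ω => fun i : S => S.restrict Z i ω :=
    measurable_pi_lambda _ fun i => hZ i
  have := fun i : S => Measure.isProbabilityMeasure_map (μ := μ) (hZ i).aemeasurable
  have h2 : ∀ i : S, IsProbabilityMeasure (μ.map (S.restrict Z i)) := this
  refine Measure.ext_of_singleton fun v => ?_
  rw [Measure.map_apply hmeas (measurableSet_singleton v), Measure.pi_singleton]
  classical
  have e : (fun ω => fun i : S => S.restrict Z i ω) ⁻¹' {v} =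
      {ω | ∀ i ∈ S, Z i ω = if hi : i ∈ S then v ⟨i, hi⟩ else 0} := by
    ext ω
    simp only [Set.mem_preimage, Set.mem_singleton_iff, Set.mem_ofPred_eq, funext_iff]
    constructor
    · intro hv i hi
      rw [dif_pos hi]
      exact hv ⟨i, hi⟩
    · rintro hv ⟨i, hi⟩
      have := hv i hi
      rwa [dif_pos hi] at this
  rw [e, ← ENNReal.toReal_eq_toReal_iff' (measure_ne_top _ _)
    (ENNReal.prod_ne_top fun i _ => measure_ne_top _ _), ENNReal.toReal_prod, ← measureReal_def,
    h S, ← Finset.prod_coe_sort]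
  refine Finset.prod_congr rfl fun i _ => ?_
  rw [dif_pos i.2, ← h.mass,
    Measure.map_apply (show Measurable (S.restrict Z i) from hZ i) (measurableSet_singleton _)]
  rfl

lemma HasProductMass.comp_injective {κ : Type*} (h : HasProductMass μ Z ρ) {g : κ → ι}
    (hg : g.Injective) : HasProductMass μ (fun k => Z (g k)) fun k => ρ (g k) := by
  classical
  intro S v
  rcases isEmpty_or_nonempty κ with hκ | hκ
  · rw [Finset.eq_empty_of_isEmpty S]
    simpa using h ∅ fun _ => 0
  · have h1 := h (S.map ⟨g, hg⟩) fun i => v (Function.invFun g i)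
    rw [Finset.prod_map] at h1
    simpa [Function.leftInverse_invFun hg _] using h1

/-- Marginalisation: it suffices to check the product formula on sets containing two given
indices. -/
lemma hasProductMass_of_mem [IsFiniteMeasure μ] [DecidableEq ι] (hZ : ∀ i, Measurable (Z i))
    (hρ : ∀ i, HasSum (ρ i) 1) (α β : ι)
    (h : ∀ S : Finset ι, α ∈ S → β ∈ S → ∀ v : ι → ℕ,
      μ.real {ω | ∀ i ∈ S, Z i ω = v i} = ∏ i ∈ S, ρ i (v i)) : HasProductMass μ Z ρ := by
  -- An index is removed by summing over all values of its variable.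
  have key : ∀ (S : Finset ι) (k : ι), (∀ v : ι → ℕ,
      μ.real {ω | ∀ i ∈ insert k S, Z i ω = v i} = ∏ i ∈ insert k S, ρ i (v i)) →
      ∀ v : ι → ℕ, μ.real {ω | ∀ i ∈ S, Z i ω = v i} = ∏ i ∈ S, ρ i (v i) := by
    intro S k hk v
    by_cases hkS : k ∈ S
    · rw [Finset.insert_eq_of_mem hkS] at hk
      exact hk v
    · have h1 := hasSum_measureReal_inter_fiber μ (measurableSet_forall_mem_eq hZ S v) (hZ k)
      have hne : ∀ i ∈ S, i ≠ k := fun i hi hik => hkS (hik ▸ hi)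
      have h2 : ∀ n, μ.real ({ω | ∀ i ∈ S, Z i ω = v i} ∩ {ω | Z k ω = n}) =
          (∏ i ∈ S, ρ i (v i)) * ρ k n := by
        intro n
        have h3 := hk (Function.update v k n)
        rw [Finset.prod_insert hkS, Function.update_self, mul_comm] at h3
        rw [Finset.prod_congr rfl fun i hi => by
          rw [Function.update_of_ne (hne i hi)]] at h3
        rw [← h3]
        congr 1
        ext ω
        simp only [Set.mem_inter_iff, Set.mem_ofPred_eq, Finset.forall_mem_insert,
          Function.update_self]
        rw [and_comm]
        refine and_congr_right fun _ => forall₂_congr fun i hi => ?_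
        rw [Function.update_of_ne (hne i hi)]
      simp only [h2] at h1
      have h4 := (hρ k).mul_left (∏ i ∈ S, ρ i (v i))
      rw [mul_one] at h4
      exact h1.unique h4
  intro S
  exact key S β (key (insert β S) α (h _ (by simp) (by simp)))

/-- Replacing two members of an independent family by the output of a conservative kernel which
preserves the product of their laws keeps the family independent with the same laws. -/
lemma HasProductMass.update_pair [IsFiniteMeasure μ] [DecidableEq ι] {Z' : ι → Ω → ℕ}
    (h : HasProductMass μ Z ρ) (hZ' : ∀ i, Measurable (Z' i)) (hρ : ∀ i, HasSum (ρ i) 1)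
    {α β : ι} (hαβ : α ≠ β) (heq : ∀ i, i ≠ α → i ≠ β → Z' i = Z i)
    (w : ℕ → ℕ → ℕ → ℕ → ℝ)
    (hker : ∀ (S : Finset ι) (v : ι → ℕ), α ∉ S → β ∉ S → ∀ m n : ℕ,
      μ.real ({ω | ∀ i ∈ S, Z i ω = v i} ∩ {ω | Z' α ω = m ∧ Z' β ω = n}) =
        ∑ p ∈ Finset.HasAntidiagonal.antidiagonal (m + n), w p.1 p.2 m n *
          μ.real ({ω | ∀ i ∈ S, Z i ω = v i} ∩ {ω | Z α ω = p.1 ∧ Z β ω = p.2}))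
    (hstat : ∀ m n, ∑ p ∈ Finset.HasAntidiagonal.antidiagonal (m + n),
      ρ α p.1 * ρ β p.2 * w p.1 p.2 m n = ρ α m * ρ β n) : HasProductMass μ Z' ρ := by
  refine hasProductMass_of_mem hZ' hρ α β fun S hα hβ v => ?_
  obtain ⟨T, hαT, hβT, rfl⟩ : ∃ T : Finset ι, α ∉ T ∧ β ∉ T ∧ S = insert α (insert β T) := by
    refine ⟨(S.erase α).erase β, by simp, by simp, ?_⟩
    rw [Finset.insert_erase (Finset.mem_erase.2 ⟨hαβ.symm, hβ⟩), Finset.insert_erase hα]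
  have hα' : α ∉ insert β T := by simp [hαβ, hαT]
  have hneα : ∀ i ∈ T, i ≠ α := fun i hi hik => hαT (hik ▸ hi)
  have hneβ : ∀ i ∈ T, i ≠ β := fun i hi hik => hβT (hik ▸ hi)
  have hset : ∀ (Y : ι → Ω → ℕ) (u : ι → ℕ), {ω | ∀ i ∈ insert α (insert β T), Y i ω = u i} =
      {ω | ∀ i ∈ T, Y i ω = u i} ∩ {ω | Y α ω = u α ∧ Y β ω = u β} := by
    intro Y u
    ext ω
    simp only [Finset.forall_mem_insert, Set.mem_inter_iff, Set.mem_ofPred_eq]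
    tauto
  have hT : {ω | ∀ i ∈ T, Z' i ω = v i} = {ω | ∀ i ∈ T, Z i ω = v i} := by
    ext ω
    refine forall₂_congr fun i hi => ?_
    rw [heq i (hneα i hi) (hneβ i hi)]
  have hin : ∀ p : ℕ × ℕ,
      μ.real ({ω | ∀ i ∈ T, Z i ω = v i} ∩ {ω | Z α ω = p.1 ∧ Z β ω = p.2}) =
        ρ α p.1 * ρ β p.2 * ∏ i ∈ T, ρ i (v i) := by
    intro p
    set u := Function.update (Function.update v α p.1) β p.2 with hu
    have uα : u α = p.1 := by rw [hu, Function.update_of_ne hαβ, Function.update_self]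
    have uβ : u β = p.2 := by rw [hu, Function.update_self]
    have uT : ∀ i ∈ T, u i = v i := fun i hi => by
      rw [hu, Function.update_of_ne (hneβ i hi), Function.update_of_ne (hneα i hi)]
    have h1 := h (insert α (insert β T)) u
    rw [hset, Finset.prod_insert hα', Finset.prod_insert hβT, uα, uβ] at h1
    rw [Finset.prod_congr rfl fun i hi => by rw [uT i hi], ← mul_assoc] at h1
    rw [← h1]
    congr 2
    ext ω
    exact forall₂_congr fun i hi => by rw [uT i hi]
  rw [hset, hT, hker T v hαT hβT, Finset.prod_insert hα', Finset.prod_insert hβT, ← mul_assoc,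
    ← hstat, Finset.sum_mul]
  refine Finset.sum_congr rfl fun p _ => ?_
  rw [hin]
  ring

end

/-! ### Transition probabilities of the model -/

lemma measurable_config_m {J : ℕ} (a b : ℕ) : Measurable fun p : PathConfig J => p.m a b := by
  have h : Measurable fun p : PathConfig J => (p.m, p.j) := comap_measurable _
  exact ((measurable_pi_apply b).comp ((measurable_pi_apply a).comp measurable_fst)).comp h

lemma measurable_config_j {J : ℕ} (a b : ℕ) : Measurable fun p : PathConfig J => p.j a b := by
  have h : Measurable fun p : PathConfig J => (p.m, p.j) := comap_measurable _
  exact ((measurable_pi_apply b).comp ((measurable_pi_apply a).comp measurable_snd)).comp h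

lemma past_le {J : ℕ} (a b : ℕ) :
    past (J := J) a b ≤ (inferInstance : MeasurableSpace (PathConfig J)) := by
  refine sup_le (iSup_le fun c => iSup_le fun r => iSup_le fun _ => ?_)
    (iSup_le fun c => iSup_le fun r => iSup_le fun _ => ?_)
  · exact (measurable_config_m c r).comap_le
  · exact (measurable_config_j c r).comap_le

lemma measurableSet_past_m {J : ℕ} {a b c r : ℕ} (h : c < a ∨ r ≤ b) (n : ℕ) :
    MeasurableSet[past a b] {p : PathConfig J | p.m c r = n} := by
  have hle : MeasurableSpace.comap (fun p : PathConfig J => p.m c r) ⊤ ≤ past a b :=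
    le_sup_of_le_left (le_iSup_of_le c (le_iSup_of_le r (le_iSup_of_le h le_rfl)))
  exact hle _ ⟨{n}, trivial, rfl⟩

lemma measurableSet_past_j {J : ℕ} {a b c r : ℕ} (h : c ≤ a ∨ r < b) (n : ℕ) :
    MeasurableSet[past a b] {p : PathConfig J | p.j c r = n} := by
  have hle : MeasurableSpace.comap (fun p : PathConfig J => p.j c r) ⊤ ≤ past a b :=
    le_sup_of_le_right (le_iSup_of_le c (le_iSup_of_le r (le_iSup_of_le h le_rfl)))
  exact hle _ ⟨{n}, trivial, rfl⟩

/-- The vertex weights are transition probabilities, given any event of the past. -/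
lemma IsHS6VM.measureReal_inter {J : ℕ} {q : ℝ} {ξ s u : ℕ → ℝ} {μ : Measure (PathConfig J)}
    [IsProbabilityMeasure μ] (hμ : IsHS6VM q ξ s u μ) (a b i j i' j' : ℕ)
    {E : Set (PathConfig J)} (hE : MeasurableSet[past a b] E) :
    μ.real (E ∩ {p | p.m a b = i ∧ p.j a b = j} ∩ {p | p.m a (b + 1) = i' ∧ p.j (a + 1) b = j'}) =
      fusedWeight q J (ξ a * u b) (s a) i j i' j' * μ.real (E ∩ {p | p.m a b = i ∧ p.j a b = j}) := by
  set F : Set (PathConfig J) := E ∩ {p | p.m a b = i ∧ p.j a b = j} with hF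
  set O : Set (PathConfig J) := {p | p.m a (b + 1) = i' ∧ p.j (a + 1) b = j'} with hO
  have hFp : MeasurableSet[past a b] F :=
    hE.inter ((measurableSet_past_m (Or.inr le_rfl) i).inter
      (measurableSet_past_j (Or.inl le_rfl) j))
  have hFm : MeasurableSet F := past_le a b F hFp
  have hOm : MeasurableSet O :=
    (measurable_config_m a (b + 1) (measurableSet_singleton i')).inter
      (measurable_config_j (a + 1) b (measurableSet_singleton j'))
  have hint : Integrable (O.indicator fun _ => (1 : ℝ)) μ := (integrable_const 1).indicator hOm
  have h1 := setIntegral_condExp (past_le a b) hint hFp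
  rw [setIntegral_congr_ae (g := fun p => fusedWeight q J (ξ a * u b) (s a) (p.m a b) (p.j a b) i' j')
    hFm ((hμ a b i' j').mono fun p hp _ => hp)] at h1
  rw [setIntegral_congr_fun (g := fun _ => fusedWeight q J (ξ a * u b) (s a) i j i' j') hFm
    (fun p hp => by simp only []; rw [hp.2.1, hp.2.2]), setIntegral_const,
    setIntegral_indicator hOm, setIntegral_const, smul_eq_mul, smul_eq_mul, mul_one] at h1
  rw [← h1, mul_comm]

/-- Conservation leaves finitely many inputs for a given output, so the law of the output is a
finite sum. -/
lemma IsHS6VM.measureReal_inter_eq_sum {J : ℕ} {q : ℝ} {ξ s u : ℕ → ℝ} {μ : Measure (PathConfig J)}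
    [IsProbabilityMeasure μ] (hμ : IsHS6VM q ξ s u μ) (a b i' j' : ℕ)
    {E : Set (PathConfig J)} (hE : MeasurableSet[past a b] E) :
    μ.real (E ∩ {p | p.m a (b + 1) = i' ∧ p.j (a + 1) b = j'}) =
      ∑ r ∈ Finset.HasAntidiagonal.antidiagonal (i' + j'),
        fusedWeight q J (ξ a * u b) (s a) r.1 r.2 i' j' *
          μ.real (E ∩ {p | p.m a b = r.1 ∧ p.j a b = r.2}) := by
  have hU : E ∩ {p | p.m a (b + 1) = i' ∧ p.j (a + 1) b = j'} =
      ⋃ r ∈ Finset.HasAntidiagonal.antidiagonal (i' + j'),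
        E ∩ {p | p.m a b = r.1 ∧ p.j a b = r.2} ∩
          {p | p.m a (b + 1) = i' ∧ p.j (a + 1) b = j'} := by
    ext p
    simp only [Set.mem_inter_iff, Set.mem_ofPred_eq, Set.mem_iUnion, exists_prop,
      Finset.HasAntidiagonal.mem_antidiagonal]
    constructor
    · rintro ⟨h1, h2, h3⟩
      exact ⟨(p.m a b, p.j a b), by rw [← h2, ← h3]; exact p.conservation a b,
        ⟨h1, rfl, rfl⟩, h2, h3⟩
    · rintro ⟨r, _, ⟨h1, _⟩, h2⟩
      exact ⟨h1, h2⟩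
  rw [hU, measureReal_biUnion_finset]
  · exact Finset.sum_congr rfl fun r _ => hμ.measureReal_inter a b r.1 r.2 i' j' hE
  · intro r _ r' _ hne
    refine Set.disjoint_left.2 fun p h1 h2 => hne ?_
    exact Prod.ext (h1.1.2.1.symm.trans h2.1.2.1) (h1.1.2.2.symm.trans h2.1.2.2)
  · intro r _
    exact (((past_le a b E hE).inter ((measurable_config_m a b (measurableSet_singleton _)).inter
      (measurable_config_j a b (measurableSet_singleton _))))).inter
      ((measurable_config_m a (b + 1) (measurableSet_singleton i')).inter
      (measurable_config_j (a + 1) b (measurableSet_singleton j')))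

/-! ### Moving down-right paths -/

/-- The occupation numbers along the down-right path whose vertical edge in column `x` starts at
height `τ x` and whose horizontal edge in row `t` starts in column `σ t`. -/
def pathData {J : ℕ} (τ σ : ℕ → ℕ) : ℕ ⊕ ℕ → PathConfig J → ℕ
  | Sum.inl x => fun p => p.m x (τ x)
  | Sum.inr t => fun p => p.j (σ t) t

lemma measurable_pathData {J : ℕ} (τ σ : ℕ → ℕ) (i : ℕ ⊕ ℕ) :
    Measurable (pathData (J := J) τ σ i) := by
  cases i
  · exact measurable_config_m _ _
  · exact measurable_config_j _ _

lemma measurable_boundaryData {J : ℕ} (a b : ℕ) (i : ℕ ⊕ ℕ) :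
    Measurable (boundaryData (J := J) a b i) := by
  cases i
  · exact measurable_config_m _ _
  · exact measurable_config_j _ _

section

variable {J : ℕ} {q : ℝ} {ξ s u : ℕ → ℝ} {μ : Measure (PathConfig J)} [IsProbabilityMeasure μ]
  {ρ : ℕ ⊕ ℕ → ℕ → ℝ}

/-- Local stationarity of the one-edge laws `ρ` at every vertex. -/
def LocallyStationary (q : ℝ) (J : ℕ) (ξ s u : ℕ → ℝ) (ρ : ℕ ⊕ ℕ → ℕ → ℝ) : Prop :=
  ∀ a b m n, ∑ p ∈ Finset.HasAntidiagonal.antidiagonal (m + n),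
    ρ (Sum.inl a) p.1 * ρ (Sum.inr b) p.2 * fusedWeight q J (ξ a * u b) (s a) p.1 p.2 m n =
      ρ (Sum.inl a) m * ρ (Sum.inr b) n

/-- One corner flip. The conditions `hτ`, `hσ` place the whole path in the past of the vertex, so
its kernel acts conditionally on all the other edges. -/
lemma HasProductMass.pathData_update (hμ : IsHS6VM q ξ s u μ) (hρ : ∀ i, HasSum (ρ i) 1)
    (hstat : LocallyStationary q J ξ s u ρ) {τ σ : ℕ → ℕ}
    (h : HasProductMass μ (pathData τ σ) ρ) {a b : ℕ} (ha : τ a = b) (hb : σ b = a)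
    (hτ : ∀ x, x < a ∨ τ x ≤ b) (hσ : ∀ t, σ t ≤ a ∨ t < b) :
    HasProductMass μ (pathData (Function.update τ a (b + 1)) (Function.update σ b (a + 1))) ρ := by
  refine h.update_pair (measurable_pathData _ _) hρ (α := Sum.inl a) (β := Sum.inr b) (by simp) ?_
    (fun i j i' j' => fusedWeight q J (ξ a * u b) (s a) i j i' j') ?_ (hstat a b)
  · rintro (x | t) h1 h2
    · have : x ≠ a := fun hx => h1 (by rw [hx])
      simp [pathData, Function.update_of_ne this]
    · have : t ≠ b := fun ht => h2 (by rw [ht])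
      simp [pathData, Function.update_of_ne this]
  · intro S v _ _ m n
    have hE : MeasurableSet[past a b] {p : PathConfig J | ∀ i ∈ S, pathData τ σ i p = v i} := by
      have e : {p : PathConfig J | ∀ i ∈ S, pathData τ σ i p = v i} =
          ⋂ i ∈ S, {p | pathData τ σ i p = v i} := by ext; simp
      rw [e]
      refine S.measurableSet_biInter fun i _ => ?_
      rcases i with x | t
      · exact measurableSet_past_m (hτ x) _
      · exact measurableSet_past_j (hσ t) _
    have := hμ.measureReal_inter_eq_sum a b m n hE
    simpa [pathData, ha, hb] using this

/-- Flips the corners of column `a` from the bottom up; columns from `a` onwards must still rest on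
the axis. -/
lemma HasProductMass.pathData_column (hμ : IsHS6VM q ξ s u μ) (hρ : ∀ i, HasSum (ρ i) 1)
    (hstat : LocallyStationary q J ξ s u ρ) {τ σ : ℕ → ℕ}
    (h : HasProductMass μ (pathData τ σ) ρ) {a T : ℕ} (hτ : ∀ x, a ≤ x → τ x = 0)
    (hσ : ∀ t, σ t ≤ a) (hσT : ∀ t < T, σ t = a) :
    ∀ r ≤ T, HasProductMass μ
      (pathData (Function.update τ a r) fun t => if t < r then a + 1 else σ t) ρ := by
  intro r
  induction r with
  | zero =>
    intro _
    have e : Function.update τ a 0 = τ := by rw [← hτ a le_rfl, Function.update_eq_self]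
    simpa [e] using h
  | succ r ih =>
    intro hr
    have h1 := (ih (by omega)).pathData_update hμ hρ hstat (a := a) (b := r)
      (Function.update_self _ _ _) (by rw [if_neg (lt_irrefl r)]; exact hσT r hr) ?_ ?_
    · rw [Function.update_idem] at h1
      have e : Function.update (fun t => if t < r then a + 1 else σ t) r (a + 1) =
          fun t => if t < r + 1 then a + 1 else σ t := by
        funext t
        rcases eq_or_ne t r with rfl | hne
        · simp
        · rw [Function.update_of_ne hne]
          exact if_congr (by omega) rfl rfl
      rwa [e] at h1
    · intro x
      rcases lt_trichotomy x a with hx | rfl | hx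
      · exact Or.inl hx
      · exact Or.inr (by rw [Function.update_self])
      · refine Or.inr ?_
        rw [Function.update_of_ne hx.ne', hτ x hx.le]
        exact Nat.zero_le _
    · intro t
      by_cases ht : t < r
      · exact Or.inr ht
      · rw [if_neg ht]
        exact Or.inl (hσ t)

/-- Columns left of `a` are raised to height `T`, the later ones only to `b`. For `c ≥ a` the path
thus follows both sides of the quadrant with corner `(a, b)`, up to row `T` and column `c`. -/
lemma HasProductMass.pathData_columns (hμ : IsHS6VM q ξ s u μ) (hρ : ∀ i, HasSum (ρ i) 1)
    (hstat : LocallyStationary q J ξ s u ρ)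
    (h : HasProductMass μ (pathData (fun _ => 0) fun _ => 0) ρ) {a b T : ℕ} (hbT : b ≤ T) (c : ℕ) :
    HasProductMass μ (pathData (fun x => if x < c then if x < a then T else b else 0)
      fun t => if t < b then c else if t < T then min c a else 0) ρ := by
  induction c with
  | zero => simpa using h
  | succ c ih =>
    have h1 := ih.pathData_column hμ hρ hstat (a := c) (T := if c < a then T else b)
      (fun x hx => if_neg (by omega)) (fun t => by split_ifs <;> omega)
      (fun t ht => by split_ifs at ht ⊢ <;> omega) _ le_rfl
    have e1 : Function.update (fun x => if x < c then if x < a then T else b else 0) c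
        (if c < a then T else b) = fun x => if x < c + 1 then if x < a then T else b else 0 := by
      funext x
      rcases eq_or_ne x c with rfl | hne
      · simp
      · rw [Function.update_of_ne hne]
        exact if_congr (by omega) rfl rfl
    have e2 : (fun t => if t < (if c < a then T else b) then c + 1 else
        if t < b then c else if t < T then min c a else 0) =
        fun t => if t < b then c + 1 else if t < T then min (c + 1) a else 0 := by
      funext t
      split_ifs <;> omega
    rwa [e1, e2] at h1

/-- Local stationarity and independence on the boundary propagate to every quadrant. -/
theorem HasProductMass.boundaryData (hμ : IsHS6VM q ξ s u μ) (hρ : ∀ i, HasSum (ρ i) 1)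
    (hstat : LocallyStationary q J ξ s u ρ)
    (h : HasProductMass μ (pathData (fun _ => 0) fun _ => 0) ρ) (a b : ℕ) :
    HasProductMass μ (boundaryData a b) fun i => ρ (Sum.map (a + ·) (b + ·) i) := by
  intro S v
  -- Finitely many flips reach only a finite part of the quadrant's boundary; `n` is large enough
  -- for that part to contain the edges of `S`.
  set n := S.sup (Sum.elim id id) + 1 with hn
  have hlt : ∀ i ∈ S, Sum.elim id id i < n := fun i hi =>
    Nat.lt_succ_of_le (Finset.le_sup (f := Sum.elim id id) hi)
  have h1 := (h.pathData_columns hμ hρ hstat (a := a) (b := b) (T := b + n) (by omega)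
    (a + n)).comp_injective (g := Sum.map (a + ·) (b + ·))
      ((add_right_injective a).sumMap (add_right_injective b)) S v
  rw [← h1]
  congr 1
  ext p
  refine forall₂_congr fun i hi => ?_
  have := hlt i hi
  rcases i with k | k
  · simp only [Sum.elim_inl, id] at this
    simp [_root_.boundaryData, pathData, this]
  · simp only [Sum.elim_inr, id] at this
    simp [_root_.boundaryData, pathData, this]

end

/-! ### Sufficiency -/

lemma hasSum_measureReal_fiber {Ω : Type*} [MeasurableSpace Ω] (μ : Measure Ω)
    [IsProbabilityMeasure μ] {X : Ω → ℕ} (hX : Measurable X) :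
    HasSum (fun n => μ.real {ω | X ω = n}) 1 := by
  simpa using hasSum_measureReal_inter_fiber μ MeasurableSet.univ hX

lemma hasLaw_map_of_measureReal_eq {Ω : Type*} [MeasurableSpace Ω] {μ : Measure Ω}
    [IsFiniteMeasure μ] {X Y : Ω → ℕ} (hX : Measurable X) (hY : Measurable Y)
    (h : ∀ n, μ.real {ω | X ω = n} = μ.real {ω | Y ω = n}) : HasLaw X (μ.map Y) μ where
  aemeasurable := hX.aemeasurable
  map_eq := by
    refine Measure.ext_of_singleton fun n => ?_
    rw [Measure.map_apply hX (measurableSet_singleton n),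
      Measure.map_apply hY (measurableSet_singleton n),
      ← ENNReal.toReal_eq_toReal_iff' (measure_ne_top _ _) (measure_ne_top _ _)]
    exact h n

/-- Independent q-negative binomial boundary data have the Burke property. -/
theorem burkeProperty_of_qnb {q : ℝ} (hq0 : 0 < q) (hq1 : q < 1) {J : ℕ} {ξ s u : ℕ → ℝ}
    (hξ : ∀ x, 0 < ξ x) (hs0 : ∀ x, 0 < s x) (hu : ∀ t, u t < 0)
    {μ : Measure (PathConfig J)} [IsProbabilityMeasure μ] (hμ : IsHS6VM q ξ s u μ) (d : ℝ)
    (hind : iIndepFun (boundaryData (J := J) 0 0) μ)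
    (hm : ∀ x, IsQNB μ q (s x ^ 2) (d / (ξ x * s x)) fun p : PathConfig J => p.m x 0)
    (hj : ∀ t, IsQNB μ q (q ^ J)⁻¹ (q ^ J * d * u t) fun p : PathConfig J => p.j 0 t) :
    BurkeProperty μ := by
  have hdata : boundaryData (J := J) 0 0 = pathData (fun _ => 0) fun _ => 0 := by
    funext i p
    cases i <;> simp [boundaryData, pathData]
  rw [hdata] at hind
  set ρ : ℕ ⊕ ℕ → ℕ → ℝ := fun i n =>
    μ.real {p | pathData (J := J) (fun _ => 0) (fun _ => 0) i p = n} with hρdef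
  have hρ : ∀ i, HasSum (ρ i) 1 := fun i =>
    hasSum_measureReal_fiber μ (measurable_pathData _ _ i)
  have h0 : HasProductMass μ (pathData (fun _ => 0) fun _ => 0) ρ := hind.hasProductMass
  obtain ⟨κ, hρm⟩ : ∃ κ : ℕ → ℝ, ∀ x n,
      ρ (Sum.inl x) n = d ^ n * qnbWeight q (s x ^ 2) (ξ x * s x)⁻¹ n * κ x := by
    refine ⟨fun x => qPochInf q (d / (ξ x * s x)) / qPochInf q (d / (ξ x * s x) * s x ^ 2),
      fun x n => ?_⟩
    rw [← qnbWeight_mul]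
    exact hm x n
  obtain ⟨κ', hρj⟩ : ∃ κ' : ℕ → ℝ, ∀ t n,
      ρ (Sum.inr t) n = d ^ n * qnbWeight q (q ^ J)⁻¹ (q ^ J * u t) n * κ' t := by
    refine ⟨fun t => qPochInf q (q ^ J * d * u t) / qPochInf q (q ^ J * d * u t * (q ^ J)⁻¹),
      fun t n => ?_⟩
    rw [← qnbWeight_mul, show d * (q ^ J * u t) = q ^ J * d * u t by ring]
    exact hj t n
  have hstat : LocallyStationary q J ξ s u ρ := by
    intro a b m n
    have key := sum_qnbWeight_mul_fusedWeight hq0 hq1 (hs0 a)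
      (mul_neg_of_pos_of_neg (hξ a) (hu b)) (ξ a * s a)⁻¹ J m n
    have e : (ξ a * s a)⁻¹ * s a * (ξ a * u b) = u b := by
      have := (hξ a).ne'
      have := (hs0 a).ne'
      field_simp
    rw [e] at key
    -- Stationarity at `d = 1` is rescaled: `d ^ (m + n)` is constant on the level, and the
    -- normalising constants do not depend on the occupation numbers.
    have key2 := congrArg (fun y => d ^ (m + n) * κ a * κ' b * y) key
    simp only [Finset.mul_sum] at key2
    simp only [hρm, hρj]
    calc _ = _ := Finset.sum_congr rfl fun p hp => by
          rw [← Finset.HasAntidiagonal.mem_antidiagonal.1 hp, pow_add]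
          ring
      _ = _ := key2
      _ = _ := by
          rw [pow_add]
          ring
  have hB := fun a b => h0.boundaryData hμ hρ hstat a b
  refine ⟨fun x => μ.map fun p => p.m x 0, fun t => μ.map fun p => p.j 0 t,
    fun x => Measure.isProbabilityMeasure_map (measurable_config_m x 0).aemeasurable,
    fun t => Measure.isProbabilityMeasure_map (measurable_config_j 0 t).aemeasurable,
    fun a b => ⟨(hB a b).iIndepFun (measurable_boundaryData a b), fun k => ?_, fun k => ?_⟩⟩
  · exact hasLaw_map_of_measureReal_eq (measurable_config_m _ _) (measurable_config_m _ _)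
      fun n => (hB a b).mass (Sum.inl k) n
  · exact hasLaw_map_of_measureReal_eq (measurable_config_j _ _) (measurable_config_j _ _)
      fun n => (hB a b).mass (Sum.inr k) n

/-! ### Necessity at a single vertex -/

lemma fusedWeight_eq_zero_of_lt (q : ℝ) {J : ℕ} (z s : ℝ) (i j i' : ℕ) {j' : ℕ} (hj' : J < j') :
    fusedWeight q J z s i j i' j' = 0 := by
  refine Finset.sum_eq_zero fun h _ => Finset.sum_eq_zero fun h' _ => ?_
  rw [if_neg]
  rintro ⟨_, h2, _⟩
  have := pathCount_le h'
  rw [pathCount, h2] at this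
  omega

/-- A sum over a level `i + j = N` of a function supported on `j ≤ J`. -/
lemma sum_antidiagonal_eq_sum_filter {J : ℕ} (N : ℕ) (F : ℕ → ℕ → ℝ)
    (hF : ∀ i j, J < j → F i j = 0) :
    ∑ p ∈ Finset.HasAntidiagonal.antidiagonal N, F p.1 p.2 =
      ∑ j ∈ (Finset.range (J + 1)).filter (· ≤ N), F (N - j) j := by
  rw [← Finset.sum_filter_of_ne (p := fun p : ℕ × ℕ => p.2 ≤ J)
    fun p _ hp => not_lt.1 fun hlt => hp (hF _ _ hlt)]
  refine Finset.sum_bij' (fun p _ => p.2) (fun j _ => (N - j, j)) ?_ ?_ ?_ ?_ ?_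
  · rintro ⟨i, j⟩ h
    simp only [Finset.mem_filter, Finset.HasAntidiagonal.mem_antidiagonal, Finset.mem_range] at h ⊢
    omega
  · intro j h
    simp only [Finset.mem_filter, Finset.HasAntidiagonal.mem_antidiagonal, Finset.mem_range] at h ⊢
    omega
  · rintro ⟨i, j⟩ h
    simp only [Finset.mem_filter, Finset.HasAntidiagonal.mem_antidiagonal] at h
    simp [← h.1]
  · intro j _
    rfl
  · rintro ⟨i, j⟩ h
    simp only [Finset.mem_filter, Finset.HasAntidiagonal.mem_antidiagonal] at h
    simp [← h.1]

/-- If independent inputs with laws `P`, `P'` of a fused vertex produce outputs with the same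
one-edge laws, then `P` and `P'` are proportional to q-negative binomial weights with a common
parameter. -/
theorem exists_qnb_of_marginal_stationary {q s z : ℝ} (hq0 : 0 < q) (hq1 : q < 1) (hs0 : 0 < s)
    (hs1 : s < 1) (hz : z < 0) {c : ℝ} (hc : 0 < c) {J : ℕ} (hJ : 1 ≤ J) (P P' : ℕ → ℝ)
    (Q : ℕ → ℕ → ℝ) (hP0 : ∀ i, 0 ≤ P i) (hP'0 : ∀ j, 0 ≤ P' j) (hPs : HasSum P 1)
    (hP's : HasSum P' 1) (hP'J : ∀ j, J < j → P' j = 0)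
    (hQ0 : ∀ i j, 0 ≤ Q i j)
    (hQ : ∀ i' j', Q i' j' = ∑ p ∈ Finset.HasAntidiagonal.antidiagonal (i' + j'),
      fusedWeight q J z s p.1 p.2 i' j' * (P p.1 * P' p.2))
    (hone : ∀ i j, (∑ p ∈ Finset.HasAntidiagonal.antidiagonal (i + j),
      fusedWeight q J z s i j p.1 p.2) * (P i * P' j) = P i * P' j)
    (hQ1 : ∀ i, HasSum (fun j => Q i j) (P i)) (hQ2 : ∀ j, HasSum (fun i => Q i j) (P' j)) :
    ∃ d : ℝ, 0 ≤ d ∧ 0 < P 0 ∧ 0 < P' 0 ∧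
      (∀ i, P i = P 0 * (d ^ i * qnbWeight q (s ^ 2) c i)) ∧
      ∀ j, P' j = P' 0 * (d ^ j * qnbWeight q (q ^ J)⁻¹ (q ^ J * (c * s * z)) j) := by
  have hs2 : s ^ 2 < 1 := by nlinarith
  set A := qnbWeight q (s ^ 2) c with hAdef
  set B := qnbWeight q (q ^ J)⁻¹ (q ^ J * (c * s * z)) with hBdef
  have hA : ∀ i, 0 < A i := qnbWeight_pos hq0 hq1 hs2 hc
  have hB : ∀ j ≤ J, 0 < B j := by
    intro j hj
    rw [hBdef, qnbWeight_inv_pow hq0 hq1 _ hj]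
    have : 0 < -(c * s * z) := by nlinarith [mul_pos hc hs0]
    have := qExchNorm_pos hq0 hq1 J j
    positivity
  have hA0 : A 0 = 1 := qnbWeight_zero _ _ _
  have hB0 : B 0 = 1 := qnbWeight_zero _ _ _
  have hBJ : ∀ j, J < j → B j = 0 := fun j hj => qnbWeight_inv_pow_eq_zero hq0 _ hj
  have hP'le : ∀ {j}, 0 < P' j → j ≤ J := fun {j} h => not_lt.1 fun hlt => h.ne' (hP'J j hlt)
  have hw0 : ∀ i j i' j', 0 < P' j → 0 ≤ fusedWeight q J z s i j i' j' := by
    intro i j i' j' hj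
    by_cases h : i + j = i' + j'
    · rcases Nat.lt_or_ge J j' with hlt | hge
      · rw [fusedWeight_eq_zero_of_lt q z s i j i' hlt]
      · exact (fusedWeight_pos hq0 hq1 hs0 hs1 hz h (hP'le hj) hge).le
    · rw [fusedWeight_eq_zero_of_ne q J z s h]
  -- Supports spread over levels: a reachable output has positive probability, and so do both of its
  -- marginals, which are again `P` and `P'`.
  have hreach : ∀ i j i' j', 0 < P i → 0 < P' j → i + j = i' + j' → j' ≤ J →
      0 < P i' ∧ 0 < P' j' := by
    intro i j i' j' hi hj h hj'
    have hpos : 0 < Q i' j' := by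
      rw [hQ]
      refine Finset.sum_pos' (fun p _ => ?_)
        ⟨(i, j), Finset.HasAntidiagonal.mem_antidiagonal.2 h, ?_⟩
      · rcases (hP'0 p.2).eq_or_lt with h0 | h0
        · rw [← h0]; simp
        · exact mul_nonneg (hw0 _ _ _ _ h0) (mul_nonneg (hP0 _) h0.le)
      · exact mul_pos (fusedWeight_pos hq0 hq1 hs0 hs1 hz h (hP'le hj) hj') (mul_pos hi hj)
    exact ⟨hpos.trans_le (le_hasSum (hQ1 i') j' fun k _ => hQ0 i' k),
      hpos.trans_le (le_hasSum (hQ2 j') i' fun k _ => hQ0 k j')⟩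
  obtain ⟨i0, hi0⟩ : ∃ i, 0 < P i := by
    by_contra! h
    have : P = fun _ => 0 := funext fun i => le_antisymm (h i) (hP0 i)
    rw [this] at hPs
    exact zero_ne_one (hasSum_zero.unique hPs)
  by_cases hcase : ∀ k, 1 ≤ k → P' k = 0
  -- With no horizontal path ever entering, a path from below could still leave to the right; so `P`
  -- is also the point mass at zero, and `d = 0`.
  · have hP'00 : P' 0 = 1 := (hasSum_single 0 fun k hk => hcase k (by omega)).unique hP's
    have hPz : ∀ i, P (i + 1) = 0 := by
      intro i
      by_contra hne
      have := (hreach (i + 1) 0 i 1 (lt_of_le_of_ne (hP0 _) (Ne.symm hne))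
        (by rw [hP'00]; exact one_pos) rfl hJ).2
      exact this.ne' (hcase 1 le_rfl)
    have hi00 : i0 = 0 := by
      cases i0 with
      | zero => rfl
      | succ n => exact absurd (hPz n) hi0.ne'
    subst hi00
    refine ⟨0, le_rfl, hi0, by rw [hP'00]; exact one_pos, fun i => ?_, fun j => ?_⟩
    · cases i with
      | zero => simp [hA0]
      | succ n => simp [hPz n]
    · cases j with
      | zero => simp [hB0]
      | succ n => simp [hcase (n + 1) (by omega)]
  · push Not at hcase
    obtain ⟨k, hk1, hk⟩ := hcase
    have hk0 : 0 < P' k := lt_of_le_of_ne (hP'0 k) (Ne.symm hk)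
    have hkJ := hP'le hk0
    -- Taking in `k` paths from the left and releasing `k - 1` raises the vertical number by one;
    -- below, taking in none and releasing one lowers it. Both supports are therefore full.
    have hup : ∀ n, 0 < P (n + i0) := by
      intro n
      induction n with
      | zero => simpa using hi0
      | succ n ih =>
        exact (hreach (n + i0) k (n + 1 + i0) (k - 1) ih hk0 (by omega) (by omega)).1
    have hP'pos : ∀ j ≤ J, 0 < P' j := fun j hj =>
      (hreach (J + i0) k (J + i0 + k - j) j (hup J) hk0 (by omega) hj).2
    have hdown : ∀ n i, 0 < P (n + i) → 0 < P i := by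
      intro n
      induction n with
      | zero => intro i h; simpa using h
      | succ n ih =>
        intro i h
        exact ih i (hreach (n + 1 + i) 0 (n + i) 1 h (hP'pos 0 (Nat.zero_le _)) (by omega) hJ).1
    have hPpos : ∀ i, 0 < P i := fun i => hdown i0 i (by rw [add_comm]; exact hup i)
    obtain ⟨C, hC⟩ := exists_abs_log_qnbWeight_le hq0 hq1 (sq_nonneg s) hs2 hc
    have hconst : ∀ {i j i' j' : ℕ}, i + j = i' + j' → j ≤ J → j' ≤ J →
        P i * P' j / (A i * B j) = P i' * P' j' / (A i' * B j') := by
      intro i j i' j' h hj hj'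
      refine density_const_on_levels J P P' A B (fusedWeight q J z s) Q C hPpos
        (fun i => le_hasSum hPs i fun k _ => hP0 k) hPs.summable hP'pos ?_ hA hC hB
        (fun i j i' j' h hj hj' => fusedWeight_pos hq0 hq1 hs0 hs1 hz h hj hj')
        ?_ ?_ ?_ hQ0 ?_ ?_ h hj hj'
      · exact (hasSum_sum_of_ne_finset_zero fun j hj => hP'J j
          (by rw [Finset.mem_range] at hj; omega)).unique hP's
      · intro N l _ hlN
        have key := sum_qnbWeight_mul_fusedWeight hq0 hq1 hs0 hz c J (N - l) l
        rw [Nat.sub_add_cancel hlN] at key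
        rw [← key, sum_antidiagonal_eq_sum_filter (J := J) N fun i j =>
          A i * B j * fusedWeight q J z s i j (N - l) l]
        intro i j hj
        rw [hBJ j hj]
        ring
      -- The model yields unit row sums only for inputs of positive probability; full support
      -- permits the cancellation.
      · intro N l hl hlN
        have key := hone (N - l) l
        rw [Nat.sub_add_cancel hlN, sum_antidiagonal_eq_sum_filter (J := J) N
          (fun i j => fusedWeight q J z s (N - l) l i j)
          fun i j hj => fusedWeight_eq_zero_of_lt q z s _ _ i hj] at key
        exact mul_right_cancel₀ (mul_pos (hPpos (N - l)) (hP'pos l hl)).ne' (by rw [key, one_mul])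
      · intro N l _ hlN
        rw [hQ, Nat.sub_add_cancel hlN, sum_antidiagonal_eq_sum_filter (J := J) N
          (fun i j => fusedWeight q J z s i j (N - l) l * (P i * P' j))]
        · exact Finset.sum_congr rfl fun j _ => mul_comm _ _
        · intro i j hj
          rw [hP'J j hj]
          ring
      · intro i
        refine (hasSum_sum_of_ne_finset_zero fun j hj => ?_).unique (hQ1 i)
        refine le_antisymm ?_ (hQ0 i j)
        rw [← hP'J j (by rw [Finset.mem_range] at hj; omega)]
        exact le_hasSum (hQ2 j) i fun k _ => hQ0 k j
      · intro j _
        have := (hPs.mul_right (P' j)).sub (hQ2 j)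
        simpa using this
    set f : ℕ → ℝ := fun i => P i / A i with hf
    set g : ℕ → ℝ := fun j => P' j / B j with hg
    have hfg : ∀ {i j i' j' : ℕ}, i + j = i' + j' → j ≤ J → j' ≤ J → f i * g j = f i' * g j' := by
      intro i j i' j' h hj hj'
      have := hconst h hj hj'
      rwa [mul_div_mul_comm, mul_div_mul_comm] at this
    have hPf : ∀ i, P i = f i * A i := fun i => (div_mul_cancel₀ _ (hA i).ne').symm
    have hPg : ∀ j ≤ J, P' j = g j * B j := fun j hj => (div_mul_cancel₀ _ (hB j hj).ne').symm
    have hf0 : f 0 = P 0 := by simp [hf, hA0]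
    have hg0 : g 0 = P' 0 := by simp [hg, hB0]
    have hg0pos : 0 < g 0 := hg0 ▸ hP'pos 0 (Nat.zero_le _)
    have hg1pos : 0 < g 1 := div_pos (hP'pos 1 hJ) (hB 1 hJ)
    have hf0pos : 0 < f 0 := hf0 ▸ hPpos 0
    -- Trading one vertical path for a horizontal one gives `f (n + 1) * g 0 = f n * g 1`, hence the
    -- ratio `d = g 1 / g 0`.
    have hfd : ∀ i, f i = f 0 * (g 1 / g 0) ^ i := by
      intro i
      induction i with
      | zero => simp
      | succ n ih =>
        have h1 := hfg (i := n + 1) (j := 0) (i' := n) (j' := 1) rfl (Nat.zero_le _) hJ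
        rw [pow_succ, ← mul_assoc, ← ih, mul_div_assoc', eq_div_iff hg0pos.ne', h1]
    refine ⟨g 1 / g 0, by positivity, hPpos 0, hP'pos 0 (Nat.zero_le _), fun i => ?_, fun j => ?_⟩
    · rw [hPf i, hfd i, hf0, mul_assoc]
    · rcases Nat.lt_or_ge J j with hlt | hge
      · rw [hP'J j hlt, hBJ j hlt]
        simp
      · have h1 := hfg (i := 0) (j := j) (i' := j) (j' := 0) (by omega) hge (Nat.zero_le _)
        rw [hfd j, mul_assoc] at h1
        have h2 := mul_left_cancel₀ hf0pos.ne' h1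
        rw [hPg j hge, h2, ← hg0]
        ring

/-! ### Necessity for the whole model -/

/-- The Burke property forces q-negative binomial boundary data. -/
theorem qnb_of_burkeProperty {q : ℝ} (hq0 : 0 < q) (hq1 : q < 1) {J : ℕ} (hJ : 1 ≤ J)
    {ξ s u : ℕ → ℝ} (hξ : ∀ x, 0 < ξ x) (hs0 : ∀ x, 0 < s x) (hs1 : ∀ x, s x < 1)
    (hu : ∀ t, u t < 0) {μ : Measure (PathConfig J)} [IsProbabilityMeasure μ]
    (hμ : IsHS6VM q ξ s u μ) (hB : BurkeProperty μ) :
    ∃ d : ℝ, 0 ≤ d ∧ (∀ x, d < ξ x * s x) ∧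
      (∀ x, IsQNB μ q (s x ^ 2) (d / (ξ x * s x)) (fun p : PathConfig J => p.m x 0)) ∧
      (∀ t, IsQNB μ q ((q ^ J)⁻¹) (q ^ J * d * u t) (fun p : PathConfig J => p.j 0 t)) := by
  obtain ⟨L, L', _, _, hL⟩ := hB
  have hm : ∀ a b n, μ.real {p : PathConfig J | p.m a b = n} = (L a).real {n} := by
    intro a b n
    have h := (hL a b).2.1 0
    rw [measureReal_def, measureReal_def]
    congr 1
    exact h.measure_eq (p := fun k => k = n) (measurableSet_singleton n)
  have hj : ∀ a b n, μ.real {p : PathConfig J | p.j a b = n} = (L' b).real {n} := by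
    intro a b n
    have h := (hL a b).2.2 0
    rw [measureReal_def, measureReal_def]
    congr 1
    exact h.measure_eq (p := fun k => k = n) (measurableSet_singleton n)
  have hin : ∀ a b i k, μ.real {p : PathConfig J | p.m a b = i ∧ p.j a b = k} =
      (L a).real {i} * (L' b).real {k} := by
    intro a b i k
    have h := (hL a b).1.hasProductMass {Sum.inl 0, Sum.inr 0} (Sum.elim (fun _ => i) fun _ => k)
    rw [Finset.prod_pair (by simp)] at h
    simpa [boundaryData, hm, hj] using h
  have hsum : ∀ a, HasSum (fun n => (L a).real {n}) 1 := by
    intro a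
    have := hasSum_measureReal_fiber μ (measurable_config_m (J := J) a 0)
    simpa only [hm] using this
  have hsum' : ∀ b, HasSum (fun n => (L' b).real {n}) 1 := by
    intro b
    have := hasSum_measureReal_fiber μ (measurable_config_j (J := J) 0 b)
    simpa only [hj] using this
  have hvertex : ∀ a b, ∃ d : ℝ, 0 ≤ d ∧ 0 < (L a).real {0} ∧ 0 < (L' b).real {0} ∧
      (∀ i, (L a).real {i} = (L a).real {0} * (d ^ i * qnbWeight q (s a ^ 2) (ξ a * s a)⁻¹ i)) ∧
      ∀ k, (L' b).real {k} =
        (L' b).real {0} * (d ^ k * qnbWeight q (q ^ J)⁻¹ (q ^ J * u b) k) := by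
    intro a b
    have e : (ξ a * s a)⁻¹ * s a * (ξ a * u b) = u b := by
      have := (hξ a).ne'
      have := (hs0 a).ne'
      field_simp
    have key := exists_qnb_of_marginal_stationary hq0 hq1 (hs0 a) (hs1 a)
      (mul_neg_of_pos_of_neg (hξ a) (hu b)) (inv_pos.2 (mul_pos (hξ a) (hs0 a))) hJ
      (fun n => (L a).real {n}) (fun n => (L' b).real {n})
      (fun i k => μ.real {p : PathConfig J | p.m a (b + 1) = i ∧ p.j (a + 1) b = k})
      (fun _ => measureReal_nonneg) (fun _ => measureReal_nonneg) (hsum a) (hsum' b)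
      ?_ (fun _ _ => measureReal_nonneg) ?_ ?_ ?_ ?_
    · rw [e] at key
      exact key
    · intro k hk
      rw [← hj 0 b]
      have : {p : PathConfig J | p.j 0 b = k} = ∅ := by
        ext p
        have := p.j_le 0 b
        simp only [Set.mem_ofPred_eq, Set.mem_empty_iff_false, iff_false]
        omega
      rw [this, measureReal_empty]
    · intro i' j'
      have := hμ.measureReal_inter_eq_sum a b i' j' (E := Set.univ) MeasurableSet.univ
      simpa only [Set.univ_inter, hin] using this
    · intro i k
      have hsumout : ∑ r ∈ Finset.HasAntidiagonal.antidiagonal (i + k),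
          μ.real ({p : PathConfig J | p.m a b = i ∧ p.j a b = k} ∩
            {p | p.m a (b + 1) = r.1 ∧ p.j (a + 1) b = r.2}) =
          μ.real {p : PathConfig J | p.m a b = i ∧ p.j a b = k} := by
        rw [← measureReal_biUnion_finset]
        · congr 1
          ext p
          simp only [Set.mem_iUnion, Set.mem_inter_iff, Set.mem_ofPred_eq, exists_prop,
            Finset.HasAntidiagonal.mem_antidiagonal]
          constructor
          · rintro ⟨r, _, h, _⟩
            exact h
          · rintro ⟨h1, h2⟩
            refine ⟨(p.m a (b + 1), p.j (a + 1) b), ?_, ⟨h1, h2⟩, rfl, rfl⟩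
            rw [← h1, ← h2]
            exact (p.conservation a b).symm
        · intro r _ r' _ hne
          refine Set.disjoint_left.2 fun p h1 h2 => hne ?_
          exact Prod.ext (h1.2.1.symm.trans h2.2.1) (h1.2.2.symm.trans h2.2.2)
        · intro r _
          exact ((measurable_config_m a b (measurableSet_singleton _)).inter
            (measurable_config_j a b (measurableSet_singleton _))).inter
            ((measurable_config_m a (b + 1) (measurableSet_singleton _)).inter
            (measurable_config_j (a + 1) b (measurableSet_singleton _)))
      have hker := fun r : ℕ × ℕ =>
        hμ.measureReal_inter a b i k r.1 r.2 (E := Set.univ) MeasurableSet.univ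
      simp only [Set.univ_inter, hin] at hker
      simp only [hker, hin] at hsumout
      rw [Finset.sum_mul]
      exact hsumout
    · intro i
      rw [← hm a (b + 1)]
      exact hasSum_measureReal_inter_fiber μ (measurable_config_m a (b + 1)
        (measurableSet_singleton i)) (measurable_config_j (a + 1) b)
    · intro k
      rw [← hj (a + 1) b]
      have := hasSum_measureReal_inter_fiber μ (measurable_config_j (a + 1) b
        (measurableSet_singleton k)) (measurable_config_m a (b + 1))
      refine this.congr_fun fun n => congrArg μ.real ?_
      ext p
      exact and_comm
  choose D hD0 hL0 hL'0 hLD hL'D using hvertex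
  have hs2 : ∀ a, s a ^ 2 < 1 := fun a => by nlinarith [hs0 a, hs1 a]
  -- The mass ratio between one and zero paths determines `D a b`. In column `a` it does not involve
  -- the row, and in row `0` it does not involve the column.
  have hcol : ∀ a b, D a b = D a 0 := by
    intro a b
    have hA : 0 < qnbWeight q (s a ^ 2) (ξ a * s a)⁻¹ 1 :=
      qnbWeight_pos hq0 hq1 (hs2 a) (inv_pos.2 (mul_pos (hξ a) (hs0 a))) 1
    have h := (hLD a b 1).symm.trans (hLD a 0 1)
    rw [pow_one, pow_one] at h
    exact mul_right_cancel₀ hA.ne' (mul_left_cancel₀ (hL0 a b).ne' h)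
  have hrow : ∀ a, D a 0 = D 0 0 := by
    intro a
    have hB1 : 0 < qnbWeight q (q ^ J)⁻¹ (q ^ J * u 0) 1 := by
      rw [qnbWeight_inv_pow hq0 hq1 _ hJ]
      have := neg_pos.2 (hu 0)
      have := qExchNorm_pos hq0 hq1 J 1
      positivity
    have h := (hL'D a 0 1).symm.trans (hL'D 0 0 1)
    rw [pow_one, pow_one] at h
    exact mul_right_cancel₀ hB1.ne' (mul_left_cancel₀ (hL'0 a 0).ne' h)
  set d := D 0 0 with hd
  have hDd : ∀ a b, D a b = d := fun a b => (hcol a b).trans (hrow a)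
  have hmass : ∀ a i, (L a).real {i} =
      (L a).real {0} * qnbWeight q (s a ^ 2) (d / (ξ a * s a)) i := by
    intro a i
    rw [div_eq_mul_inv, qnbWeight_mul, ← hDd a 0]
    exact hLD a 0 i
  have hmass' : ∀ b k, (L' b).real {k} =
      (L' b).real {0} * qnbWeight q (q ^ J)⁻¹ (q ^ J * d * u b) k := by
    intro b k
    rw [show q ^ J * d * u b = d * (q ^ J * u b) by ring, qnbWeight_mul, ← hDd 0 b]
    exact hL'D 0 b k
  have hd0 : 0 ≤ d := hD0 0 0
  have hlt : ∀ a, d / (ξ a * s a) < 1 := by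
    intro a
    refine lt_one_of_summable_qnbWeight hq0 hq1 (sq_nonneg (s a)) (hs2 a) ?_
    have h := (hsum a).summable
    rw [show (fun n => (L a).real {n}) = fun n => (L a).real {0} *
      qnbWeight q (s a ^ 2) (d / (ξ a * s a)) n from funext (hmass a), summable_mul_left_iff] at h
    · exact h
    · have := (hL0 a 0).ne'
      intro h0
      apply this
      rw [hmass, h0, zero_mul]
  refine ⟨d, hd0, fun x => ?_, fun x n => ?_, fun t n => ?_⟩
  · exact (div_lt_one (mul_pos (hξ x) (hs0 x))).1 (hlt x)
  · rw [hm x 0 n, hmass x n, mul_comm]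
    congr 1
    refine eq_qnb_of_hasSum hq0 hq1 ?_ ((hsum x).congr_fun fun n => (hmass x n).symm)
    have : 0 ≤ d / (ξ x * s x) := div_nonneg hd0 (mul_pos (hξ x) (hs0 x)).le
    nlinarith [hlt x, hs2 x, sq_nonneg (s x)]
  -- The argument `q^J d u` may lie below `-1`, but the q-binomial theorem is used only under
  -- summability; moreover `p β = d u ≤ 0`.
  · rw [hj 0 t n, hmass' t n, mul_comm]
    congr 1
    refine eq_qnb_of_hasSum hq0 hq1 ?_ ((hsum' t).congr_fun fun n => (hmass' t n).symm)
    have hq : q ^ J ≠ 0 := (pow_pos hq0 J).ne'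
    have : q ^ J * d * u t * (q ^ J)⁻¹ = d * u t := by field_simp
    rw [this]
    nlinarith [hu t]

theorem mainTheorem4 (q : ℝ) (hq0 : 0 < q) (hq1 : q < 1) (J : ℕ) (hJ : 1 ≤ J)
    (ξ s u : ℕ → ℝ) (hξ : ∀ x, 0 < ξ x) (hs0 : ∀ x, 0 < s x) (hs1 : ∀ x, s x < 1)
    (hu : ∀ t, u t < 0)
    (μ : Measure (PathConfig J)) [IsProbabilityMeasure μ] (hμ : IsHS6VM q ξ s u μ) :
    BurkeProperty μ ↔
      ∃ d : ℝ, 0 ≤ d ∧ (∀ x, d < ξ x * s x) ∧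
        iIndepFun (boundaryData (J := J) 0 0) μ ∧
        (∀ x, IsQNB μ q (s x ^ 2) (d / (ξ x * s x)) (fun p : PathConfig J => p.m x 0)) ∧
        (∀ t, IsQNB μ q ((q ^ J)⁻¹) (q ^ J * d * u t) (fun p : PathConfig J => p.j 0 t)) := by
  constructor
  · intro hB
    have hind : iIndepFun (boundaryData (J := J) 0 0) μ := by
      obtain ⟨_, _, _, _, h⟩ := hB
      exact (h 0 0).1
    obtain ⟨d, hd0, hd, hm, hj⟩ := qnb_of_burkeProperty hq0 hq1 hJ hξ hs0 hs1 hu hμ hB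
    exact ⟨d, hd0, hd, hind, hm, hj⟩
  · rintro ⟨d, _, _, hind, hm, hj⟩
    exact burkeProperty_of_qnb hq0 hq1 hξ hs0 hu hμ d hind hm hj
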